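/- **Definitions.** A *simplicial cell complex* is a topological quotient $\Sigma$ of a disjoint union of finitely many simplices $\Xi_i$ such that each tautological map $\xi_i:\Xi_i\to\Sigma$ is an embedding, and for all $i,j$ the set $\xi_i^{-1}(\xi_i(\Xi_i)\cap\xi_j(\Xi_j))$ is a union of faces of $\Xi_i$ on each of which $\xi_j^{-1}\circ\xi_i$ is affine. An *$n$-dimensional pseudomanifold* is a simplicial cell complex in which each face is contained in an $n$-dimensional face (a *chamber*) and each $(n-1)$-dimensional face is contained in precisely two chambers. The *link* of a $k$-dimensional face $\Gamma$ is obtained by choosing an interior point in each $(k+1)$-dimensional face containing $\Gamma$ and taking the union, over all faces $\Psi\supset\Gamma$, of the convex hulls in $\Psi$ of the chosen points lying in $\Psi$. A pseudomanifold (not necessarily connected) is *normal* if the link of every nonempty face of codimension $\ge 2$ is connected. Fix $n+1$ colors. A *coloring* of a normal $n$-dimensional pseudomanifold consists of: a sign $\pm$ for every chamber, such that adjacent chambers have opposite signs; a color for every vertex, such that the vertices of each chamber have pairwise different colors; a color for every $(n-1)$-dimensional face, such that the $(n-1)$-dimensional faces of each chamber have pairwise different colors and the color of such a face is the color of the opposite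 vertex of any chamber containing it. A *labeling* of a colored pseudomanifold with $2L$ chambers is a bijection of $\{1,\dots,L\}$ with the set of plus-chambers and a bijection of $\{1,\dots,L\}$ with the set of minus-chambers. Labeled colored pseudomanifolds are considered up to isomorphism, i.e. up to homeomorphisms that take faces to faces, are affine on faces (in both directions) and preserve signs, colors and labels. **Theorem.** Let $n\ge 1$ and $L\ge 0$, and let $S(L)$ be the symmetric group on $\{1,\dots,L\}$. There is a bijection between $S(L)^{n+1}$ (the factors being indexed by the $n+1$ colors) and the set of isomorphism classes of labeled colored normal $n$-dimensional pseudomanifolds with $2L$ chambers, given as follows. 1. If $(g^{(c)})_c$ corresponds to the class of $\Sigma$, then for every color $c$ and all labels $a,b$ we have $g^{(c)}(a)=b$ if and only if there is an $(n-1)$-dimensional face of color $c$ contained both in the plus-chamber with label $a$ and in the minus-chamber with label $b$. 2. Conversely, let $(g^{(c)})_c\in S(L)^{n+1}$. Take $L$ labeled plus-copies and $L$ labeled minus-copies of the $n$-simplex with vertices colored by the $n+1$ colors, and for every color $c$ and every label $a$ glue the plus-simplex with label $a$ to the minus-simplex with label $g^{(c)}(a)$ along their faces of color $c$ (opposite to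 the vertices of color $c$), preserving the colors of vertices. The resulting quotient is a normal $n$-dimensional pseudomanifold. It has a coloring and a labeling in which the plus- and minus-chambers with label $a$ are the images of the plus- and minus-simplices with label $a$, and in which the colors of vertices and of $(n-1)$-dimensional faces are those of the simplices. The class of this labeled colored pseudomanifold corresponds to $(g^{(c)})_c$. -/

import Mathlib

open Set Topology

/-- A topological quotient of a finite disjoint union of simplices: a finite family of simplices
`Ξ i` (the standard simplex with `dim i + 1` vertices) and an equivalence relation on
`∐ Ξ i`. No condition is imposed on the relation yet. -/
structure SimplexQuotient : Type 1 where
  ι : Type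
  finite_ι : Finite ι
  dim : ι → ℕ
  rel : Setoid (Σ i : ι, stdSimplex ℝ (Fin (dim i + 1)))

/-- The closed face of the standard `d`-simplex spanned by the vertices in `F`. -/
def stdFace {d : ℕ} (F : Finset (Fin (d + 1))) : Set (stdSimplex ℝ (Fin (d + 1))) :=
  {x | ∀ v, v ∉ F → x.1 v = 0}

/-- The barycenter of the face of the standard `d`-simplex spanned by the vertices in `F`. -/
noncomputable def faceBarycenter {d : ℕ} (F : Finset (Fin (d + 1))) : Fin (d + 1) → ℝ :=
  fun v => if v ∈ F then (F.card : ℝ)⁻¹ else 0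

namespace SimplexQuotient

/-- The quotient space, with the quotient topology. -/
abbrev Space (S : SimplexQuotient) : Type := Quotient S.rel

/-- The tautological map `Ξ i → Σ`. -/
def ξ (S : SimplexQuotient) (i : S.ι) (x : stdSimplex ℝ (Fin (S.dim i + 1))) : S.Space :=
  Quotient.mk S.rel ⟨i, x⟩

/-- The image in the quotient of the face of `Ξ i` spanned by the vertices in `F`. -/
def face (S : SimplexQuotient) (i : S.ι) (F : Finset (Fin (S.dim i + 1))) : Set S.Space :=
  S.ξ i '' stdFace F

/-- `A` is a `k`-dimensional face of the quotient. -/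
def IsFace (S : SimplexQuotient) (k : ℕ) (A : Set S.Space) : Prop :=
  ∃ (i : S.ι) (F : Finset (Fin (S.dim i + 1))), F.card = k + 1 ∧ A = S.face i F

/-- Simplicial cell complexes. -/
structure IsSimplicialCellComplex (S : SimplexQuotient) : Prop where
  /-- Each simplex is embedded. -/
  isEmbedding : ∀ i, IsEmbedding (S.ξ i)
  /-- The part of `Ξ i` that lies in the image of `Ξ j` is a union of faces of `Ξ i`. -/
  inter_eq_iUnion : ∀ i j, ∃ 𝓕 : Set (Finset (Fin (S.dim i + 1))),
    S.ξ i ⁻¹' (range (S.ξ i) ∩ range (S.ξ j)) = ⋃ F ∈ 𝓕, stdFace F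
  /-- The partially defined map `Ξ i → Σ → Ξ j` is affine on each face in its domain. -/
  affine : ∀ i j (F : Finset (Fin (S.dim i + 1))),
    stdFace F ⊆ S.ξ i ⁻¹' (range (S.ξ i) ∩ range (S.ξ j)) →
    ∃ T : (Fin (S.dim i + 1) → ℝ) →ᵃ[ℝ] (Fin (S.dim j + 1) → ℝ),
      ∀ x ∈ stdFace F, ∃ y : stdSimplex ℝ (Fin (S.dim j + 1)),
        y.1 = T x.1 ∧ S.ξ j y = S.ξ i x

/-- Pseudomanifolds of dimension `n`: simplicial cell complexes in which every face lies in an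
`n`-dimensional face, and every `(n - 1)`-dimensional face lies in precisely two. -/
structure IsPseudomanifold (S : SimplexQuotient) (n : ℕ) : Prop where
  isSimplicialCellComplex : S.IsSimplicialCellComplex
  exists_chamber : ∀ k A, S.IsFace k A → ∃ C, S.IsFace n C ∧ A ⊆ C
  two_chambers : ∀ k, k + 1 = n → ∀ A, S.IsFace k A → {C | S.IsFace n C ∧ A ⊆ C}.ncard = 2

/-- The link of a face `Γ`: the union, over all faces `Ψ ⊇ Γ`, of the convex hull in `Ψ` of
chosen interior points (here the barycenters) of those faces of `Ψ` that contain `Γ` and have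
one more vertex than `Γ`. Here `Ψ = S.face i G` and `Γ = S.face i F` with `F ⊆ G`. -/
def link (S : SimplexQuotient) (Γ : Set S.Space) : Set S.Space :=
  {p | ∃ (i : S.ι) (F G : Finset (Fin (S.dim i + 1))), F ⊆ G ∧ S.face i F = Γ ∧
    ∃ x : stdSimplex ℝ (Fin (S.dim i + 1)),
      x.1 ∈ convexHull ℝ {b | ∃ v ∈ G, v ∉ F ∧ b = faceBarycenter (insert v F)} ∧ p = S.ξ i x}

/-- Normal pseudomanifolds of dimension `n`: the link of every (nonempty) face of codimension at
least two is connected. -/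
structure IsNormalPseudomanifold (S : SimplexQuotient) (n : ℕ) : Prop where
  isPseudomanifold : S.IsPseudomanifold n
  link_connected : ∀ k, k + 2 ≤ n → ∀ Γ, S.IsFace k Γ → IsConnected (S.link Γ)

/-- Chambers: the `n`-dimensional faces. -/
def Chamber (S : SimplexQuotient) (n : ℕ) : Type := {A : Set S.Space // S.IsFace n A}

/-- Vertices: the `0`-dimensional faces. -/
def Vertex (S : SimplexQuotient) : Type := {A : Set S.Space // S.IsFace 0 A}

/-- Facets: the `(n - 1)`-dimensional faces. -/
def Facet (S : SimplexQuotient) (n : ℕ) : Type :=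
  {A : Set S.Space // ∃ k, k + 1 = n ∧ S.IsFace k A}

/-- Colorings, with the set of colors `Fin (n + 1)`. The sign of a chamber is `1` (plus) or
`-1` (minus). -/
structure Coloring (S : SimplexQuotient) (n : ℕ) where
  sign : S.Chamber n → ℤˣ
  vertexColor : S.Vertex → Fin (n + 1)
  facetColor : S.Facet n → Fin (n + 1)
  /-- Adjacent chambers have opposite signs. -/
  sign_adjacent : ∀ (C D : S.Chamber n) (A : S.Facet n), C ≠ D → A.1 ⊆ C.1 → A.1 ⊆ D.1 →
    sign D = -sign C
  /-- The vertices of a chamber have pairwise different colors. -/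
  vertexColor_ne : ∀ (C : S.Chamber n) (v w : S.Vertex), v.1 ⊆ C.1 → w.1 ⊆ C.1 → v ≠ w →
    vertexColor v ≠ vertexColor w
  /-- The facets of a chamber have pairwise different colors. -/
  facetColor_ne : ∀ (C : S.Chamber n) (A B : S.Facet n), A.1 ⊆ C.1 → B.1 ⊆ C.1 → A ≠ B →
    facetColor A ≠ facetColor B
  /-- The color of a facet is the color of the opposite vertex in any chamber containing it. -/
  facetColor_eq : ∀ (C : S.Chamber n) (A : S.Facet n) (v : S.Vertex), A.1 ⊆ C.1 → v.1 ⊆ C.1 →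
    ¬ v.1 ⊆ A.1 → facetColor A = vertexColor v

/-- Labelings of a colored complex: numberings of the plus-chambers and of the minus-chambers
by `L` labels. In particular there are `2 L` chambers. -/
structure Labeling {S : SimplexQuotient} {n : ℕ} (κ : S.Coloring n) (L : ℕ) where
  plus : Fin L ≃ {C : S.Chamber n // κ.sign C = 1}
  minus : Fin L ≃ {C : S.Chamber n // κ.sign C = -1}

/-- A map `f` that is affine on every face which it sends onto a face. -/
def AffineOnFaces (S S' : SimplexQuotient) (f : S.Space → S'.Space) : Prop :=
  ∀ i (F : Finset (Fin (S.dim i + 1))) j (G : Finset (Fin (S'.dim j + 1))),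
    f '' S.face i F = S'.face j G →
    ∃ T : (Fin (S.dim i + 1) → ℝ) →ᵃ[ℝ] (Fin (S'.dim j + 1) → ℝ),
      ∀ x ∈ stdFace F, ∃ y ∈ stdFace G, y.1 = T x.1 ∧ S'.ξ j y = f (S.ξ i x)

end SimplexQuotient

/-- Labeled colored normal `n`-dimensional pseudomanifolds with `2 L` chambers. -/
structure LabeledColoredPseudomanifold (n L : ℕ) : Type 1 where
  S : SimplexQuotient
  isNormal : S.IsNormalPseudomanifold n
  coloring : S.Coloring n
  labeling : SimplexQuotient.Labeling coloring L

namespace LabeledColoredPseudomanifold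

/-- Isomorphisms of labeled colored pseudomanifolds: homeomorphisms that match the faces, are
affine on faces in both directions, and preserve signs, colors and labels. -/
structure Iso {n L : ℕ} (P Q : LabeledColoredPseudomanifold n L) where
  f : P.S.Space ≃ₜ Q.S.Space
  isFace_iff : ∀ k A, P.S.IsFace k A ↔ Q.S.IsFace k (f '' A)
  affine : SimplexQuotient.AffineOnFaces P.S Q.S f
  affine_symm : SimplexQuotient.AffineOnFaces Q.S P.S f.symm
  sign_eq : ∀ (C : P.S.Chamber n) (D : Q.S.Chamber n), D.1 = f '' C.1 →
    Q.coloring.sign D = P.coloring.sign C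
  vertexColor_eq : ∀ (v : P.S.Vertex) (w : Q.S.Vertex), w.1 = f '' v.1 →
    Q.coloring.vertexColor w = P.coloring.vertexColor v
  facetColor_eq : ∀ (A : P.S.Facet n) (B : Q.S.Facet n), B.1 = f '' A.1 →
    Q.coloring.facetColor B = P.coloring.facetColor A
  plus_eq : ∀ a, (Q.labeling.plus a).1.1 = f '' (P.labeling.plus a).1.1
  minus_eq : ∀ a, (Q.labeling.minus a).1.1 = f '' (P.labeling.minus a).1.1

theorem iso_refl {n L : ℕ} (P : LabeledColoredPseudomanifold n L) : Nonempty (Iso P P) := by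
  have key : SimplexQuotient.AffineOnFaces P.S P.S id := by
    intro i F j G h
    rw [image_id] at h
    have hsub : ∀ x ∈ stdFace F, ∃ y ∈ stdFace G, P.S.ξ j y = P.S.ξ i x := by
      intro x hx
      have : P.S.ξ i x ∈ P.S.face j G := h ▸ mem_image_of_mem _ hx
      exact this
    have hc := P.isNormal.isPseudomanifold.isSimplicialCellComplex
    obtain ⟨T, hT⟩ := hc.affine i j F (by
      intro x hx
      obtain ⟨y, -, hy⟩ := hsub x hx
      exact ⟨mem_range_self x, y, hy⟩)
    refine ⟨T, fun x hx => ?_⟩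
    obtain ⟨y, hy, hy'⟩ := hsub x hx
    obtain ⟨z, hz, hz'⟩ := hT x hx
    have : z = y := (hc.isEmbedding j).injective (hz'.trans hy'.symm)
    subst this
    exact ⟨z, hy, hz, hz'⟩
  refine ⟨⟨Homeomorph.refl _, ?_, key, key, ?_, ?_, ?_, ?_, ?_⟩⟩
  · intro k A; simp
  · intro C D h
    have : D = C := Subtype.ext (by simpa using h)
    rw [this]
  · intro C D h
    have : D = C := Subtype.ext (by simpa using h)
    rw [this]
  · intro C D h
    have : D = C := Subtype.ext (by simpa using h)
    rw [this]
  · intro a; simp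
  · intro a; simp

theorem iso_symm {n L : ℕ} {P Q : LabeledColoredPseudomanifold n L} (e : Iso P Q) :
    Nonempty (Iso Q P) := by
  have himg : ∀ A : Set Q.S.Space, e.f '' (e.f.symm '' A) = A := fun A => by
    rw [← image_comp]; simp
  have himg' : ∀ A : Set P.S.Space, e.f.symm '' (e.f '' A) = A := fun A => by
    rw [← image_comp]; simp
  refine ⟨⟨e.f.symm, ?_, e.affine_symm, e.affine, ?_, ?_, ?_, ?_, ?_⟩⟩
  · intro k A
    rw [e.isFace_iff, himg]
  · intro C D h
    exact (e.sign_eq D C (by rw [h, himg])).symm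
  · intro C D h
    exact (e.vertexColor_eq D C (by rw [h, himg])).symm
  · intro C D h
    exact (e.facetColor_eq D C (by rw [h, himg])).symm
  · intro a; rw [e.plus_eq, himg']
  · intro a; rw [e.minus_eq, himg']

theorem affineOnFaces_comp {S S' S'' : SimplexQuotient} {f : S.Space → S'.Space}
    {g : S'.Space → S''.Space} (hface : ∀ k A, S.IsFace k A → S'.IsFace k (f '' A))
    (hf : SimplexQuotient.AffineOnFaces S S' f) (hg : SimplexQuotient.AffineOnFaces S' S'' g) :
    SimplexQuotient.AffineOnFaces S S'' (g ∘ f) := by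
  intro i F k H h
  rcases F.eq_empty_or_nonempty with rfl | hF
  · refine ⟨AffineMap.const ℝ _ 0, fun x hx => ?_⟩
    exfalso
    have h1 := x.2.2
    have h2 : ∀ v, x.1 v = 0 := fun v => hx v (by simp)
    simp [h2] at h1
  · obtain ⟨j, G, -, hG⟩ := hface (F.card - 1) (S.face i F)
      ⟨i, F, by have := hF.card_pos; omega, rfl⟩
    obtain ⟨T, hT⟩ := hf i F j G hG
    obtain ⟨U, hU⟩ := hg j G k H (by rw [← hG, ← image_comp]; exact h)
    refine ⟨U.comp T, fun x hx => ?_⟩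
    obtain ⟨y, hy, hyT, hy'⟩ := hT x hx
    obtain ⟨z, hz, hzU, hz'⟩ := hU y hy
    exact ⟨z, hz, by rw [hzU, hyT]; rfl, by rw [hz', hy']; rfl⟩

theorem iso_trans {n L : ℕ} {P Q R : LabeledColoredPseudomanifold n L} (e : Iso P Q)
    (e' : Iso Q R) : Nonempty (Iso P R) := by
  have himg : ∀ A : Set P.S.Space, (e.f.trans e'.f) '' A = e'.f '' (e.f '' A) := fun A => by
    rw [← image_comp]; rfl
  have hsymm : ∀ k A, R.S.IsFace k A → Q.S.IsFace k (e'.f.symm '' A) := by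
    intro k A hA
    rw [e'.isFace_iff, ← image_comp]
    simpa using hA
  refine ⟨⟨e.f.trans e'.f, ?_, ?_, ?_, ?_, ?_, ?_, ?_, ?_⟩⟩
  · intro k A
    rw [himg, e.isFace_iff, e'.isFace_iff]
  · exact affineOnFaces_comp (f := e.f) (g := e'.f) (fun k A h => (e.isFace_iff k A).1 h)
      e.affine e'.affine
  · exact affineOnFaces_comp (f := e'.f.symm) (g := e.f.symm) hsymm e'.affine_symm e.affine_symm
  · intro C D h
    rw [himg] at h
    rw [e'.sign_eq ⟨e.f '' C.1, (e.isFace_iff _ _).1 C.2⟩ D h]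
    exact e.sign_eq C _ rfl
  · intro C D h
    rw [himg] at h
    rw [e'.vertexColor_eq ⟨e.f '' C.1, (e.isFace_iff _ _).1 C.2⟩ D h]
    exact e.vertexColor_eq C _ rfl
  · intro C D h
    rw [himg] at h
    obtain ⟨k, hk, hC⟩ := C.2
    rw [e'.facetColor_eq ⟨e.f '' C.1, k, hk, (e.isFace_iff _ _).1 hC⟩ D h]
    exact e.facetColor_eq C _ rfl
  · intro a; rw [himg, e'.plus_eq, e.plus_eq]
  · intro a; rw [himg, e'.minus_eq, e.minus_eq]

/-- The relation of being isomorphic. -/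
instance isoSetoid (n L : ℕ) : Setoid (LabeledColoredPseudomanifold n L) where
  r P Q := Nonempty (Iso P Q)
  iseqv := ⟨iso_refl, fun ⟨e⟩ => iso_symm e, fun ⟨e⟩ ⟨e'⟩ => iso_trans e e'⟩

/-- The set of labeled colored normal `n`-dimensional pseudomanifolds with `2 L` chambers (up to
isomorphism). -/
abbrev IsoClass (n L : ℕ) : Type 1 := Quotient (isoSetoid n L)

end LabeledColoredPseudomanifold

/-- One elementary gluing: if the permutation of color `c` sends `a` to `b`, the plus-simplex
with label `a` and the minus-simplex with label `b` are glued along their faces of color `c`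
(opposite to the vertex `c`), each vertex to the vertex of the same color. -/
inductive GlueStep {n L : ℕ} (g : Fin (n + 1) → Equiv.Perm (Fin L)) :
    (Σ _ : ℤˣ × Fin L, stdSimplex ℝ (Fin (n + 1))) →
    (Σ _ : ℤˣ × Fin L, stdSimplex ℝ (Fin (n + 1))) → Prop
  | glue (c : Fin (n + 1)) (a : Fin L) (x : stdSimplex ℝ (Fin (n + 1))) (hx : x.1 c = 0) :
      GlueStep g ⟨(1, a), x⟩ ⟨(-1, g c a), x⟩

/-- The space glued from `L` labeled plus-simplices and `L` labeled minus-simplices, with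
vertices indexed by the colors, as the permutations `g` prescribe. -/
def gluing {n L : ℕ} (g : Fin (n + 1) → Equiv.Perm (Fin L)) : SimplexQuotient where
  ι := ℤˣ × Fin L
  finite_ι := inferInstance
  dim := fun _ => n
  rel := Relation.EqvGen.setoid (GlueStep g)

/-- The colorings and labelings of the glued space that come from the simplices it is glued of. -/
structure IsStandardLabeling {n L : ℕ} (g : Fin (n + 1) → Equiv.Perm (Fin L))
    (κ : (gluing g).Coloring n) (lab : SimplexQuotient.Labeling κ L) : Prop where
  plus_eq : ∀ a : Fin L, (lab.plus a).1.1 = range ((gluing g).ξ ((1, a) : ℤˣ × Fin L))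
  minus_eq : ∀ a : Fin L, (lab.minus a).1.1 = range ((gluing g).ξ ((-1, a) : ℤˣ × Fin L))
  vertexColor_eq : ∀ (v : (gluing g).Vertex) (i : ℤˣ × Fin L) (c : Fin (n + 1)),
    v.1 = (gluing g).face i ({c} : Finset (Fin (n + 1))) → κ.vertexColor v = c
  facetColor_eq : ∀ (A : (gluing g).Facet n) (i : ℤˣ × Fin L) (c : Fin (n + 1)),
    A.1 = (gluing g).face i (Finset.univ.erase c : Finset (Fin (n + 1))) → κ.facetColor A = c

/-! A coloring rigidifies a pseudomanifold. Every chamber is a copy of the standard simplex with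
vertices indexed by the colors, and transition maps between simplices are affine on faces and take
vertices to vertices of the same color, so identified points have equal color coordinates
(`exists_map_eq`). Hence the space is determined by the relations `Agree φ F`, for nonempty sets `F`
of colors: two chambers have the same face with vertex colors `F`. An `IsAtlas` records this
description. Two complexes with atlases and the same identifications are isomorphic by the map that
is the identity in every chart (`nonempty_iso`).

A facet lies in exactly two chambers, of opposite signs, so sharing a facet of color `c` is a
bijection from plus-chambers to minus-chambers, that is, a permutation (`exists_perm`). The main
point is that these permutations determine all relations `Agree φ F`: each is generated by crossings
of facets whose color is not in `F` (`reflTransGen_facetAdj`). This is where normality enters. The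
link of a face is a finite union of closed pieces, one for each chamber around the face. If some of
these chambers could not be reached by crossings, connectedness would give a point common to a
reachable and an unreachable piece. That point is interior to a strictly larger face, which both
chambers contain, and induction on the codimension joins them.

Conversely, in the glued space the relations are generated by facet crossings by construction
(`chart_eq_iff`). In codimension at least two, the link pieces of adjacent chambers meet, so links
are connected (`isConnected_link`). The permutations are recovered from adjacency of chambers, which
is invariant under isomorphism. -/

/-- The set of vertices at which a point of the standard simplex has nonzero coordinate. -/
noncomputable def stdSupp {d : ℕ} (x : stdSimplex ℝ (Fin (d + 1))) : Finset (Fin (d + 1)) :=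
  Finset.univ.filter fun v => x.1 v ≠ 0

/-! ### Supports, faces and affine maps of standard simplices -/

section Simplex

variable {d e : ℕ}

theorem mem_stdSupp {x : stdSimplex ℝ (Fin (d + 1))} {v : Fin (d + 1)} :
    v ∈ stdSupp x ↔ x.1 v ≠ 0 := by simp [stdSupp]

theorem mem_stdFace_iff {F : Finset (Fin (d + 1))} {x : stdSimplex ℝ (Fin (d + 1))} :
    x ∈ stdFace F ↔ stdSupp x ⊆ F := by
  constructor
  · intro h v hv
    by_contra hF
    exact mem_stdSupp.1 hv (h v hF)
  · intro h v hv
    by_contra hF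
    exact hv (h (mem_stdSupp.2 hF))

theorem mem_stdFace_stdSupp (x : stdSimplex ℝ (Fin (d + 1))) : x ∈ stdFace (stdSupp x) :=
  mem_stdFace_iff.2 subset_rfl

theorem stdFace_mono {F G : Finset (Fin (d + 1))} (h : F ⊆ G) :
    stdFace F ⊆ stdFace G := fun _ hx =>
  mem_stdFace_iff.2 ((mem_stdFace_iff.1 hx).trans h)

theorem stdFace_univ : stdFace (Finset.univ : Finset (Fin (d + 1))) = univ :=
  eq_univ_of_forall fun _ _ hv => absurd (Finset.mem_univ _) hv

theorem stdSupp_nonempty (x : stdSimplex ℝ (Fin (d + 1))) : (stdSupp x).Nonempty := by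
  by_contra h
  rw [Finset.not_nonempty_iff_eq_empty] at h
  have h2 : ∀ v, x.1 v = 0 := fun v => by
    by_contra hv
    simpa [h] using mem_stdSupp.2 hv
  have h1 := x.2.2
  simp [h2] at h1

theorem isClosed_stdFace (F : Finset (Fin (d + 1))) : IsClosed (stdFace F) := by
  have : stdFace F = ⋂ v, ⋂ (_ : v ∉ F), {x : stdSimplex ℝ (Fin (d + 1)) | x.1 v = 0} := by
    ext x; simp [stdFace]
  rw [this]
  refine isClosed_iInter fun v => isClosed_iInter fun _ => ?_
  exact isClosed_eq ((continuous_apply v).comp continuous_subtype_val) continuous_const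

theorem vertex_mem_stdFace {F : Finset (Fin (d + 1))} {v : Fin (d + 1)} :
    stdSimplex.vertex (S := ℝ) v ∈ stdFace F ↔ v ∈ F := by
  constructor
  · intro h
    by_contra hv
    have := h v hv
    simp at this
  · intro h w hw
    have hne : w ≠ v := by
      rintro rfl
      exact hw h
    exact Pi.single_eq_of_ne hne _

theorem eq_vertex_of_mem_stdFace {v : Fin (d + 1)} {x : stdSimplex ℝ (Fin (d + 1))}
    (h : x ∈ stdFace {v}) : x = stdSimplex.vertex v := by
  have h0 : ∀ w, w ≠ v → x.1 w = 0 := fun w hw => h w (by simpa using hw)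
  have h1 : x.1 v = 1 := by
    rw [← x.2.2]
    exact (Finset.sum_eq_single v (fun w _ hw => h0 w hw) (by simp)).symm
  apply Subtype.ext
  funext w
  by_cases hw : w = v
  · subst hw; simp [h1]
  · rw [h0 w hw]; simp [hw]

theorem stdFace_singleton (v : Fin (d + 1)) :
    stdFace {v} = {stdSimplex.vertex (S := ℝ) v} := by
  ext x
  refine ⟨eq_vertex_of_mem_stdFace, ?_⟩
  rintro rfl
  exact vertex_mem_stdFace.2 (Finset.mem_singleton_self v)

theorem stdSupp_vertex (v : Fin (d + 1)) : stdSupp (stdSimplex.vertex (S := ℝ) v) = {v} := by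
  ext w
  simp [mem_stdSupp, Pi.single_apply]

theorem faceBarycenter_mem {F : Finset (Fin (d + 1))} (hF : F.Nonempty) :
    faceBarycenter F ∈ stdSimplex ℝ (Fin (d + 1)) := by
  refine ⟨fun v => ?_, ?_⟩
  · unfold faceBarycenter
    split_ifs <;> positivity
  · have : (F.card : ℝ) ≠ 0 := by exact_mod_cast hF.card_pos.ne'
    simp [faceBarycenter, this]

theorem exists_stdSupp_eq {F : Finset (Fin (d + 1))} (hF : F.Nonempty) :
    ∃ x : stdSimplex ℝ (Fin (d + 1)), x.1 = faceBarycenter F ∧ stdSupp x = F := by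
  refine ⟨⟨faceBarycenter F, faceBarycenter_mem hF⟩, rfl, ?_⟩
  ext v
  rw [mem_stdSupp]
  have : (F.card : ℝ) ≠ 0 := by exact_mod_cast hF.card_pos.ne'
  by_cases hv : v ∈ F <;> simp [faceBarycenter, hv, this]

theorem stdFace_subset_iff {F G : Finset (Fin (d + 1))} : stdFace F ⊆ stdFace G ↔ F ⊆ G := by
  refine ⟨fun h => ?_, stdFace_mono⟩
  intro v hv
  exact vertex_mem_stdFace.1 (h (vertex_mem_stdFace.2 hv))

/-- The coordinates of a pushforward along an injective map. -/
theorem map_apply_of_injective {τ : Fin (d + 1) → Fin (e + 1)} (hτ : τ.Injective)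
    (x : stdSimplex ℝ (Fin (d + 1))) (v : Fin (d + 1)) :
    (stdSimplex.map τ x).1 (τ v) = x.1 v := by
  change FunOnFinite.linearMap ℝ ℝ τ x.1 (τ v) = x.1 v
  rw [FunOnFinite.linearMap_apply_apply]
  simp [hτ.eq_iff, Finset.sum_filter]

theorem map_apply_of_notMem {τ : Fin (d + 1) → Fin (e + 1)}
    (x : stdSimplex ℝ (Fin (d + 1))) {w : Fin (e + 1)} (h : w ∉ range τ) :
    (stdSimplex.map τ x).1 w = 0 := by
  change FunOnFinite.linearMap ℝ ℝ τ x.1 w = 0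
  rw [FunOnFinite.linearMap_apply_apply]
  refine Finset.sum_eq_zero fun v hv => absurd ⟨v, ?_⟩ h
  simpa using hv

theorem stdSupp_map {τ : Fin (d + 1) → Fin (e + 1)} (hτ : τ.Injective)
    (x : stdSimplex ℝ (Fin (d + 1))) : stdSupp (stdSimplex.map τ x) = (stdSupp x).image τ := by
  ext w
  rw [mem_stdSupp, Finset.mem_image]
  by_cases hw : w ∈ range τ
  · obtain ⟨v, rfl⟩ := hw
    rw [map_apply_of_injective hτ]
    simp [mem_stdSupp, hτ.eq_iff]
  · rw [map_apply_of_notMem x hw]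
    simp only [ne_eq, not_true_eq_false, false_iff]
    rintro ⟨v, -, rfl⟩
    exact hw ⟨v, rfl⟩

theorem map_image_stdFace {τ : Fin (d + 1) → Fin (e + 1)} (hτ : τ.Injective)
    (F : Finset (Fin (d + 1))) :
    stdSimplex.map τ '' stdFace F = stdFace (F.image τ) := by
  ext y
  constructor
  · rintro ⟨x, hx, rfl⟩
    rw [mem_stdFace_iff, stdSupp_map hτ]
    exact Finset.image_subset_image (mem_stdFace_iff.1 hx)
  · intro hy
    have hs : ∑ v, y.1 (τ v) = 1 := by
      rw [← y.2.2, ← Finset.sum_image (s := Finset.univ) (g := τ) (f := y.1)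
        (fun a _ b _ h => hτ h)]
      refine Finset.sum_subset (Finset.subset_univ _) fun w _ hw => hy w fun h => hw ?_
      exact Finset.image_subset_image (Finset.subset_univ _) h
    refine ⟨⟨fun v => y.1 (τ v), fun v => y.2.1 _, hs⟩, fun v hv => hy _ ?_, ?_⟩
    · simpa [hτ.eq_iff] using hv
    · apply Subtype.ext
      funext w
      by_cases hw : w ∈ range τ
      · obtain ⟨v, rfl⟩ := hw
        rw [map_apply_of_injective hτ]
      · rw [map_apply_of_notMem _ hw, hy w]
        rintro h
        obtain ⟨v, -, rfl⟩ := Finset.mem_image.1 h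
        exact hw ⟨v, rfl⟩

/-- The equivalence of standard simplices induced by an equivalence of vertices. -/
noncomputable def stdSimplexCongr (γ : Fin (d + 1) ≃ Fin (e + 1)) :
    stdSimplex ℝ (Fin (d + 1)) ≃ stdSimplex ℝ (Fin (e + 1)) where
  toFun := stdSimplex.map γ
  invFun := stdSimplex.map γ.symm
  left_inv x := by rw [stdSimplex.map_comp_apply]; simp
  right_inv x := by rw [stdSimplex.map_comp_apply]; simp

/-- If an affine map sends the smallest face containing `x` into a standard simplex, then it
sends it into the smallest face containing the image of `x`. -/
theorem stdSupp_subset_of_affine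
    (T : (Fin (d + 1) → ℝ) →ᵃ[ℝ] (Fin (e + 1) → ℝ)) {x : stdSimplex ℝ (Fin (d + 1))}
    (hT : ∀ z ∈ stdFace (stdSupp x), T z.1 ∈ stdSimplex ℝ (Fin (e + 1)))
    {y : stdSimplex ℝ (Fin (e + 1))} (hy : y.1 = T x.1)
    {z : stdSimplex ℝ (Fin (d + 1))} (hz : z ∈ stdFace (stdSupp x))
    {w : stdSimplex ℝ (Fin (e + 1))} (hw : w.1 = T z.1) : w ∈ stdFace (stdSupp y) := by
  -- The segment from `z` to `x` extends beyond `x` to `x + t (x - z)` inside the face when `t` is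
  -- the least nonzero coordinate of `x`. At a vertex where `y` vanishes, the image of this endpoint
  -- has coordinate `-t` times that of `w`, which must be nonnegative.
  obtain ⟨v₀, hv₀, hmin⟩ := Finset.exists_min_image (stdSupp x) x.1 (stdSupp_nonempty x)
  set t := x.1 v₀ with ht
  have htpos : 0 < t := lt_of_le_of_ne (x.2.1 v₀) (Ne.symm (mem_stdSupp.1 hv₀))
  have hpt : ∀ v, (AffineMap.lineMap x.1 z.1 (-t) : Fin (d + 1) → ℝ) v
      = x.1 v + t * (x.1 v - z.1 v) := by
    intro v
    simp [AffineMap.lineMap_apply]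
    ring
  have hmem : (AffineMap.lineMap x.1 z.1 (-t) : Fin (d + 1) → ℝ) ∈ stdSimplex ℝ (Fin (d + 1)) := by
    refine ⟨fun v => ?_, ?_⟩
    · rw [hpt]
      by_cases hv : v ∈ stdSupp x
      · have h1 := hmin v hv
        have h2 : z.1 v ≤ 1 := stdSimplex.le_one z v
        have h3 := x.2.1 v
        nlinarith [mul_nonneg htpos.le h3, mul_le_mul_of_nonneg_left h2 htpos.le]
      · rw [hz v hv, mem_stdFace_stdSupp x v hv]; simp
    · simp only [hpt, Finset.sum_add_distrib, ← Finset.mul_sum, Finset.sum_sub_distrib, x.2.2, z.2.2]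
      simp
  have hface : (⟨_, hmem⟩ : stdSimplex ℝ (Fin (d + 1))) ∈ stdFace (stdSupp x) := by
    intro v hv
    change (AffineMap.lineMap x.1 z.1 (-t) : Fin (d + 1) → ℝ) v = 0
    rw [hpt, hz v hv, mem_stdFace_stdSupp x v hv]; simp
  have hpos := (hT _ hface).1
  intro u hu
  have h0 := mem_stdFace_stdSupp y u hu
  have h1 := hpos u
  simp only [AffineMap.apply_lineMap, ← hy, ← hw] at h1
  have h2 : (AffineMap.lineMap y.1 w.1 (-t) : Fin (e + 1) → ℝ) u
      = y.1 u + t * (y.1 u - w.1 u) := by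
    simp [AffineMap.lineMap_apply]
    ring
  rw [h2, h0] at h1
  have h3 := w.2.1 u
  nlinarith

theorem sum_smul_vertex (x : stdSimplex ℝ (Fin (d + 1))) :
    x.1 = ∑ v, x.1 v • (stdSimplex.vertex (S := ℝ) v).1 := by
  funext w
  simp [Finset.sum_apply, Pi.single_apply]

/-- An affine map evaluated at a point of the simplex. -/
theorem affine_apply_eq_sum {E : Type*} [AddCommGroup E] [Module ℝ E]
    (T : (Fin (d + 1) → ℝ) →ᵃ[ℝ] E) (x : stdSimplex ℝ (Fin (d + 1))) :
    T x.1 = ∑ v, x.1 v • T (stdSimplex.vertex (S := ℝ) v).1 := by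
  have h : x.1 = Finset.univ.affineCombination ℝ
      (fun v => (stdSimplex.vertex (S := ℝ) v).1) x.1 := by
    rw [Finset.affineCombination_eq_linear_combination _ _ _ x.2.2]
    exact sum_smul_vertex x
  conv_lhs => rw [h]
  rw [Finset.map_affineCombination _ _ _ x.2.2,
    Finset.affineCombination_eq_linear_combination _ _ _ x.2.2]
  rfl

end Simplex

/-! ### Identifications between the simplices of a cell complex -/

namespace SimplexQuotient

variable {S : SimplexQuotient}

theorem face_univ (i : S.ι) : S.face i Finset.univ = range (S.ξ i) := by
  rw [face, stdFace_univ, image_univ]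

theorem face_singleton (i : S.ι) (v : Fin (S.dim i + 1)) :
    S.face i {v} = {S.ξ i (stdSimplex.vertex v)} := by
  rw [face, stdFace_singleton, image_singleton]

theorem continuous_ξ (i : S.ι) : Continuous (S.ξ i) :=
  continuous_quotient_mk'.comp continuous_sigmaMk

namespace IsSimplicialCellComplex

/-- The overlap is a union of faces, and any face containing `x` contains the smallest one. -/
theorem face_stdSupp_subset_preimage (hS : S.IsSimplicialCellComplex) {i j : S.ι}
    {x : stdSimplex ℝ (Fin (S.dim i + 1))} (h : S.ξ i x ∈ range (S.ξ j)) :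
    stdFace (stdSupp x) ⊆ S.ξ i ⁻¹' (range (S.ξ i) ∩ range (S.ξ j)) := by
  obtain ⟨𝓕, h𝓕⟩ := hS.inter_eq_iUnion i j
  have hx : x ∈ ⋃ F ∈ 𝓕, stdFace F := h𝓕 ▸ ⟨mem_range_self x, h⟩
  simp only [mem_iUnion] at hx
  obtain ⟨F, hF, hxF⟩ := hx
  rw [h𝓕]
  exact (stdFace_mono (mem_stdFace_iff.1 hxF)).trans (subset_biUnion_of_mem (u := stdFace) hF)

/-- Two simplices that meet in a point are identified by an affine map on the smallest face
containing that point. -/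
theorem exists_affine (hS : S.IsSimplicialCellComplex) {i j : S.ι}
    {x : stdSimplex ℝ (Fin (S.dim i + 1))} {y : stdSimplex ℝ (Fin (S.dim j + 1))}
    (h : S.ξ i x = S.ξ j y) :
    ∃ T : (Fin (S.dim i + 1) → ℝ) →ᵃ[ℝ] (Fin (S.dim j + 1) → ℝ),
      ∀ z ∈ stdFace (stdSupp x), ∃ w ∈ stdFace (stdSupp y), w.1 = T z.1 ∧ S.ξ j w = S.ξ i z := by
  obtain ⟨T, hT⟩ := hS.affine i j (stdSupp x) (hS.face_stdSupp_subset_preimage ⟨y, h.symm⟩)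
  refine ⟨T, fun z hz => ?_⟩
  obtain ⟨w, hw, hw'⟩ := hT z hz
  refine ⟨w, ?_, hw, hw'⟩
  refine stdSupp_subset_of_affine T (fun z hz => ?_) ?_ hz hw
  · obtain ⟨w, hw, -⟩ := hT z hz
    exact hw ▸ w.2
  · obtain ⟨y', hy', hy''⟩ := hT x (mem_stdFace_stdSupp x)
    rwa [(hS.isEmbedding j).injective (hy''.trans h)] at hy'

/-- The identification is used backwards: it sends the smallest face containing `w` into the
smallest face containing the vertex `v`, a single point. By injectivity the face of `w` is a single
point too. -/
theorem exists_vertex_eq (hS : S.IsSimplicialCellComplex) {i j : S.ι}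
    {v : Fin (S.dim i + 1)} {w : stdSimplex ℝ (Fin (S.dim j + 1))}
    (h : S.ξ i (stdSimplex.vertex v) = S.ξ j w) : ∃ u, w = stdSimplex.vertex u := by
  obtain ⟨u, hu⟩ := stdSupp_nonempty w
  refine ⟨u, ?_⟩
  obtain ⟨T, hT⟩ := hS.exists_affine h.symm
  obtain ⟨z, hz, -, hz'⟩ := hT (stdSimplex.vertex u) (vertex_mem_stdFace.2 hu)
  rw [stdSupp_vertex] at hz
  rw [eq_vertex_of_mem_stdFace hz, h] at hz'
  exact (hS.isEmbedding j).injective hz'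

theorem card_le_of_face_subset (hS : S.IsSimplicialCellComplex) {i j : S.ι}
    {F : Finset (Fin (S.dim i + 1))} {G : Finset (Fin (S.dim j + 1))}
    (h : S.face i F ⊆ S.face j G) : F.card ≤ G.card := by
  have key : ∀ v, ∃ u, v ∈ F →
      u ∈ G ∧ S.ξ j (stdSimplex.vertex u) = S.ξ i (stdSimplex.vertex v) := by
    intro v
    by_cases hv : v ∈ F
    · obtain ⟨w, hw, hw'⟩ := h (mem_image_of_mem _ (vertex_mem_stdFace.2 hv))
      obtain ⟨u, rfl⟩ := hS.exists_vertex_eq hw'.symm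
      exact ⟨u, fun _ => ⟨vertex_mem_stdFace.1 hw, hw'⟩⟩
    · exact ⟨0, fun h => absurd h hv⟩
  choose σ hσ using key
  refine Finset.card_le_card_of_injOn σ (fun v hv => (hσ v hv).1) ?_
  intro v hv v' hv' hvv'
  apply stdSimplex.vertex_injective (S := ℝ)
  apply (hS.isEmbedding i).injective
  rw [← (hσ v hv).2, ← (hσ v' hv').2, hvv']

/-- If the vertices of all simplices are colored, compatibly with the identifications, then
identified points have the same coordinates with respect to the colors. -/
theorem exists_map_eq (hS : S.IsSimplicialCellComplex) {n : ℕ}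
    {γ : ∀ i, Fin (S.dim i + 1) → Fin (n + 1)}
    (hγ : ∀ i j v u, S.ξ i (stdSimplex.vertex v) = S.ξ j (stdSimplex.vertex u) → γ i v = γ j u)
    {i j : S.ι} {x : stdSimplex ℝ (Fin (S.dim i + 1))} {y : stdSimplex ℝ (Fin (S.dim j + 1))}
    (h : S.ξ i x = S.ξ j y) {z : stdSimplex ℝ (Fin (S.dim i + 1))} (hz : z ∈ stdFace (stdSupp x)) :
    ∃ w, S.ξ j w = S.ξ i z ∧ stdSimplex.map (γ j) w = stdSimplex.map (γ i) z := by
  obtain ⟨T, hT⟩ := hS.exists_affine h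
  obtain ⟨w, -, hwT, hw⟩ := hT z hz
  refine ⟨w, hw, Subtype.ext ?_⟩
  change FunOnFinite.linearMap ℝ ℝ (γ j) w.1 = FunOnFinite.linearMap ℝ ℝ (γ i) z.1
  -- Both sides are affine in `z`, so it suffices to compare them at the vertices in the support of
  -- `x`; the other vertices have weight zero.
  conv_rhs => rw [sum_smul_vertex z]
  rw [hwT, affine_apply_eq_sum T z, map_sum, map_sum]
  refine Finset.sum_congr rfl fun v _ => ?_
  rw [map_smul, map_smul]
  by_cases hv : v ∈ stdSupp x
  · congr 1
    obtain ⟨w', -, hw'T, hw'⟩ := hT (stdSimplex.vertex v) (vertex_mem_stdFace.2 hv)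
    obtain ⟨u, rfl⟩ := hS.exists_vertex_eq hw'.symm
    rw [← hw'T]
    have h1 := stdSimplex.map_vertex (S := ℝ) (γ j) u
    have h2 := stdSimplex.map_vertex (S := ℝ) (γ i) v
    rw [hγ j i u v hw', ← h2] at h1
    exact congrArg Subtype.val h1
  · rw [hz v hv, zero_smul, zero_smul]

/-- Closedness is tested in each simplex, where the preimage is a finite union of closed faces. -/
theorem isClosed_range (hS : S.IsSimplicialCellComplex) (j : S.ι) : IsClosed (range (S.ξ j)) := by
  have hq : IsQuotientMap (Quotient.mk S.rel) := isQuotientMap_quot_mk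
  rw [← hq.isClosed_preimage, isClosed_sigma_iff]
  intro i
  obtain ⟨𝓕, h𝓕⟩ := hS.inter_eq_iUnion i j
  have : Sigma.mk i ⁻¹' (Quotient.mk S.rel ⁻¹' range (S.ξ j)) = ⋃ F ∈ 𝓕, stdFace F := by
    rw [← h𝓕]
    ext x
    exact ⟨fun h => ⟨mem_range_self x, h⟩, fun h => h.2⟩
  rw [this]
  exact 𝓕.toFinite.isClosed_biUnion fun F _ => isClosed_stdFace F

end IsSimplicialCellComplex

/-! ### Atlases of chambers -/

/-- The parametrizations `φ m` and `φ m'` agree on the face of the standard simplex spanned by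
the vertices in `F`. -/
def Agree {n : ℕ} {M : Type} (φ : M → stdSimplex ℝ (Fin (n + 1)) → S.Space)
    (F : Finset (Fin (n + 1))) (m m' : M) : Prop :=
  ∀ z ∈ stdFace F, φ m z = φ m' z

/-- A family of parametrizations of the chambers of a simplicial cell complex by the standard
simplex, such that every simplex lies in a chamber, and the standard simplices are glued along
faces by the identity map. -/
structure IsAtlas {n : ℕ} {M : Type} (φ : M → stdSimplex ℝ (Fin (n + 1)) → S.Space) : Prop where
  isComplex : S.IsSimplicialCellComplex
  eq_of_eq : ∀ m m' x y, φ m x = φ m' y → x = y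
  agree_of_eq : ∀ m m' x, φ m x = φ m' x → Agree φ (stdSupp x) m m'
  exists_factor : ∀ i, ∃ (m : M) (τ : Fin (S.dim i + 1) → Fin (n + 1)), τ.Injective ∧
    ∀ x, S.ξ i x = φ m (stdSimplex.map τ x)
  exists_param : ∀ m, ∃ (i : S.ι) (γ : Fin (S.dim i + 1) ≃ Fin (n + 1)),
    ∀ x, S.ξ i x = φ m (stdSimplex.map γ x)
  eq_of_agree : ∀ m m', Agree φ Finset.univ m m' → m = m'

/-- The union of the simplices of the link, in a simplex with vertex set `Fin (n + 1)`, of the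
face spanned by the vertices in `F`. -/
def linkSimplex {n : ℕ} (F : Finset (Fin (n + 1))) : Set (stdSimplex ℝ (Fin (n + 1))) :=
  {x | x.1 ∈ convexHull ℝ {b | ∃ v, v ∉ F ∧ b = faceBarycenter (insert v F)}}

theorem linearMap_faceBarycenter {d e : ℕ} {τ : Fin (d + 1) → Fin (e + 1)} (hτ : τ.Injective)
    (F : Finset (Fin (d + 1))) :
    FunOnFinite.linearMap ℝ ℝ τ (faceBarycenter F) = faceBarycenter (F.image τ) := by
  funext w
  rw [FunOnFinite.linearMap_apply_apply]
  by_cases hw : ∃ v, τ v = w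
  · obtain ⟨v, rfl⟩ := hw
    simp [hτ.eq_iff, Finset.sum_filter, faceBarycenter, Finset.card_image_of_injective _ hτ]
  · rw [Finset.sum_eq_zero]
    · rw [faceBarycenter, if_neg]
      intro h
      obtain ⟨v, -, h⟩ := Finset.mem_image.1 h
      exact hw ⟨v, h⟩
    · intro v hv
      exact absurd ⟨v, by simpa using hv⟩ hw

namespace IsAtlas

variable {n : ℕ} {M : Type} {φ : M → stdSimplex ℝ (Fin (n + 1)) → S.Space}

theorem injective (h : IsAtlas φ) (m : M) : Function.Injective (φ m) :=
  fun x y hxy => h.eq_of_eq m m x y hxy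

theorem eq_comp (_h : IsAtlas φ) {m : M} {i : S.ι} {γ : Fin (S.dim i + 1) ≃ Fin (n + 1)}
    (hγ : ∀ x, S.ξ i x = φ m (stdSimplex.map γ x)) (x : stdSimplex ℝ (Fin (n + 1))) :
    φ m x = S.ξ i (stdSimplex.map γ.symm x) := by
  rw [hγ]
  congr 1
  exact ((stdSimplexCongr γ).apply_symm_apply x).symm

theorem continuous (h : IsAtlas φ) (m : M) : Continuous (φ m) := by
  obtain ⟨i, γ, hγ⟩ := h.exists_param m
  have : φ m = S.ξ i ∘ stdSimplex.map γ.symm := funext (h.eq_comp hγ)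
  rw [this]
  exact (continuous_ξ i).comp (stdSimplex.continuous_map _)

theorem isClosed_image (h : IsAtlas φ) (m : M) {K : Set (stdSimplex ℝ (Fin (n + 1)))}
    (hK : IsClosed K) : IsClosed (φ m '' K) := by
  obtain ⟨i, γ, hγ⟩ := h.exists_param m
  have hcl : IsClosedEmbedding (S.ξ i) :=
    ⟨h.isComplex.isEmbedding i, h.isComplex.isClosed_range i⟩
  have : φ m '' K = S.ξ i '' (stdSimplex.map γ ⁻¹' K) := by
    ext p
    constructor
    · rintro ⟨x, hx, rfl⟩
      refine ⟨stdSimplex.map γ.symm x, ?_, (h.eq_comp hγ x).symm⟩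
      have : stdSimplex.map γ (stdSimplex.map γ.symm x) = x :=
        (stdSimplexCongr γ).apply_symm_apply x
      rwa [mem_preimage, this]
    · rintro ⟨x, hx, rfl⟩
      exact ⟨_, hx, (hγ x).symm⟩
  rw [this]
  exact hcl.isClosedMap _ (hK.preimage (stdSimplex.continuous_map _))

theorem face_eq {i : S.ι} {m : M} {τ : Fin (S.dim i + 1) → Fin (n + 1)} (hτ : τ.Injective)
    (h : ∀ x, S.ξ i x = φ m (stdSimplex.map τ x)) (F : Finset (Fin (S.dim i + 1))) :
    S.face i F = φ m '' stdFace (F.image τ) := by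
  rw [← map_image_stdFace hτ, ← image_comp, face]
  exact image_congr fun x _ => h x

theorem exists_face_eq (h : IsAtlas φ) (m : M) (F : Finset (Fin (n + 1))) :
    ∃ (i : S.ι) (G : Finset (Fin (S.dim i + 1))), G.card = F.card ∧
      φ m '' stdFace F = S.face i G := by
  obtain ⟨i, γ, hγ⟩ := h.exists_param m
  refine ⟨i, F.image γ.symm, Finset.card_image_of_injective _ γ.symm.injective, ?_⟩
  rw [face_eq γ.injective hγ, Finset.image_image]
  simp

theorem isFace_iff (h : IsAtlas φ) (k : ℕ) (A : Set S.Space) :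
    S.IsFace k A ↔ ∃ m, ∃ F : Finset (Fin (n + 1)), F.card = k + 1 ∧ A = φ m '' stdFace F := by
  constructor
  · rintro ⟨i, F, hF, rfl⟩
    obtain ⟨m, τ, hτ, hm⟩ := h.exists_factor i
    exact ⟨m, F.image τ, by rw [Finset.card_image_of_injective _ hτ, hF], face_eq hτ hm F⟩
  · rintro ⟨m, F, hF, rfl⟩
    obtain ⟨i, G, hG, hG'⟩ := h.exists_face_eq m F
    exact ⟨i, G, hG.trans hF, hG'⟩

theorem isFace_chamber_iff (h : IsAtlas φ) (A : Set S.Space) :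
    S.IsFace n A ↔ ∃ m, A = range (φ m) := by
  rw [h.isFace_iff]
  refine exists_congr fun m => ⟨?_, ?_⟩
  · rintro ⟨F, hF, rfl⟩
    rw [(Finset.card_eq_iff_eq_univ F).1 (by simpa using hF), stdFace_univ, image_univ]
  · rintro rfl
    exact ⟨Finset.univ, by simp, by rw [stdFace_univ, image_univ]⟩

theorem isFace_image (h : IsAtlas φ) (m : M) {F : Finset (Fin (n + 1))} {k : ℕ}
    (hF : F.card = k + 1) : S.IsFace k (φ m '' stdFace F) :=
  (h.isFace_iff k _).2 ⟨m, F, hF, rfl⟩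

/-- Identified points have equal coordinates, so inclusions between faces of the quotient become
statements about vertex sets and agreement of charts. -/
theorem image_subset_iff (h : IsAtlas φ) {m m' : M} {F G : Finset (Fin (n + 1))} :
    φ m '' stdFace F ⊆ φ m' '' stdFace G ↔ F ⊆ G ∧ Agree φ F m m' := by
  constructor
  · intro hs
    have hsub : ∀ x ∈ stdFace F, x ∈ stdFace G ∧ φ m x = φ m' x := by
      intro x hx
      obtain ⟨y, hy, hxy⟩ := hs (mem_image_of_mem _ hx)
      obtain rfl := h.eq_of_eq _ _ _ _ hxy
      exact ⟨hy, hxy.symm⟩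
    exact ⟨stdFace_subset_iff.1 fun x hx => (hsub x hx).1, fun x hx => (hsub x hx).2⟩
  · rintro ⟨hFG, ha⟩ _ ⟨x, hx, rfl⟩
    exact ⟨x, stdFace_mono hFG hx, (ha x hx).symm⟩

theorem image_eq_iff (h : IsAtlas φ) {m m' : M} {F G : Finset (Fin (n + 1))} :
    φ m '' stdFace F = φ m' '' stdFace G ↔ F = G ∧ Agree φ F m m' := by
  constructor
  · intro hs
    have h1 := h.image_subset_iff.1 hs.subset
    have h2 := h.image_subset_iff.1 hs.symm.subset
    exact ⟨h1.1.antisymm h2.1, h1.2⟩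
  · rintro ⟨rfl, ha⟩
    exact (h.image_subset_iff.2 ⟨subset_rfl, ha⟩).antisymm
      (h.image_subset_iff.2 ⟨subset_rfl, fun x hx => (ha x hx).symm⟩)

theorem image_subset_range_iff (h : IsAtlas φ) {m m' : M} {F : Finset (Fin (n + 1))} :
    φ m '' stdFace F ⊆ range (φ m') ↔ Agree φ F m m' := by
  rw [← image_univ, ← stdFace_univ, h.image_subset_iff]
  simp

theorem range_eq_iff (h : IsAtlas φ) {m m' : M} : range (φ m) = range (φ m') ↔ m = m' := by
  refine ⟨fun hr => h.eq_of_agree _ _ ?_, fun hm => hm ▸ rfl⟩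
  rw [← image_univ, ← image_univ, ← stdFace_univ, h.image_eq_iff] at hr
  exact hr.2

/-- Chambers suffice to compute the link: every simplex sits in a chamber by an injection of
vertices, which takes barycenters of faces to barycenters, and a whole chamber may serve as `Ψ`. -/
theorem link_eq (h : IsAtlas φ) (m : M) (F : Finset (Fin (n + 1))) :
    S.link (φ m '' stdFace F) = ⋃ m' ∈ {m' | Agree φ F m m'}, φ m' '' linkSimplex F := by
  ext p
  simp only [mem_iUnion, exists_prop, mem_ofPred_eq]
  constructor
  · rintro ⟨i, F', G, -, hF', x, hx, rfl⟩
    obtain ⟨m', τ, hτ, hm⟩ := h.exists_factor i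
    rw [face_eq hτ hm, eq_comm, h.image_eq_iff] at hF'
    obtain ⟨rfl, ha⟩ := hF'
    refine ⟨m', ha, stdSimplex.map τ x, ?_, (hm x).symm⟩
    have h1 := mem_image_of_mem (FunOnFinite.linearMap ℝ ℝ τ) hx
    rw [LinearMap.image_convexHull] at h1
    refine convexHull_mono ?_ h1
    rintro _ ⟨_, ⟨v, -, hv, rfl⟩, rfl⟩
    refine ⟨τ v, fun hv' => ?_, ?_⟩
    · obtain ⟨u, hu, huv⟩ := Finset.mem_image.1 hv'
      exact hv (hτ huv ▸ hu)
    · rw [linearMap_faceBarycenter hτ, Finset.image_insert]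
  · rintro ⟨m', ha, x, hx, rfl⟩
    obtain ⟨i, γ, hγ⟩ := h.exists_param m'
    have hF : (F.image γ.symm).image γ = F := by rw [Finset.image_image]; simp
    refine ⟨i, F.image γ.symm, Finset.univ, Finset.subset_univ _, ?_, stdSimplex.map γ.symm x,
      ?_, h.eq_comp hγ x⟩
    · rw [face_eq γ.injective hγ, hF, eq_comm, h.image_eq_iff]
      exact ⟨rfl, ha⟩
    · have hx' : x.1 ∈ convexHull ℝ {b | ∃ v, v ∉ F ∧ b = faceBarycenter (insert v F)} := hx
      have h1 := mem_image_of_mem (FunOnFinite.linearMap ℝ ℝ γ.symm) hx'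
      rw [LinearMap.image_convexHull] at h1
      refine convexHull_mono ?_ h1
      rintro _ ⟨_, ⟨v, hv, rfl⟩, rfl⟩
      refine ⟨γ.symm v, Finset.mem_univ _, fun hv' => ?_, ?_⟩
      · obtain ⟨u, hu, huv⟩ := Finset.mem_image.1 hv'
        exact hv (γ.symm.injective huv ▸ hu)
      · rw [linearMap_faceBarycenter γ.symm.injective, Finset.image_insert]

end IsAtlas

end SimplexQuotient

/-! ### Maps between complexes with matching atlases -/

namespace SimplexQuotient

namespace IsAtlas

variable {S S' : SimplexQuotient} {n : ℕ} {M : Type}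
  {φ : M → stdSimplex ℝ (Fin (n + 1)) → S.Space} {ψ : M → stdSimplex ℝ (Fin (n + 1)) → S'.Space}

theorem exists_eq (h : IsAtlas φ) (p : S.Space) : ∃ m x, φ m x = p := by
  induction p using Quotient.ind with
  | _ p =>
    obtain ⟨i, x⟩ := p
    obtain ⟨m, τ, -, hm⟩ := h.exists_factor i
    exact ⟨m, _, (hm x).symm⟩

/-- Atlases with the same identifications are related by a continuous map. -/
theorem exists_continuous [Finite M] (h : IsAtlas φ) (h' : IsAtlas ψ)
    (hφψ : ∀ m m' x, φ m x = φ m' x → ψ m x = ψ m' x) :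
    ∃ f : S.Space → S'.Space, Continuous f ∧ ∀ m x, f (φ m x) = ψ m x := by
  choose μ ξ hμξ using h.exists_eq
  have hf : ∀ m x, ψ (μ (φ m x)) (ξ (φ m x)) = ψ m x := by
    intro m x
    have h1 := hμξ (φ m x)
    have h2 := h.eq_of_eq _ _ _ _ h1
    rw [h2] at h1 ⊢
    exact hφψ _ _ _ h1
  refine ⟨fun p => ψ (μ p) (ξ p), ?_, hf⟩
  rw [continuous_iff_isClosed]
  intro A hA
  -- Charts are closed maps and there are finitely many, so this union is closed.
  have : (fun p => ψ (μ p) (ξ p)) ⁻¹' A = ⋃ m, φ m '' (ψ m ⁻¹' A) := by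
    ext p
    obtain ⟨m, x, rfl⟩ := h.exists_eq p
    simp only [mem_preimage, hf, mem_iUnion]
    constructor
    · exact fun hx => ⟨m, x, hx, rfl⟩
    · rintro ⟨m', y, hy, hyx⟩
      rw [mem_preimage, ← hf m', hyx, hf] at hy
      exact hy
  rw [this]
  exact isClosed_iUnion_of_finite fun m => h.isClosed_image m (hA.preimage (h'.continuous m))

theorem exists_homeomorph [Finite M] (h : IsAtlas φ) (h' : IsAtlas ψ)
    (hφψ : ∀ m m' x, φ m x = φ m' x ↔ ψ m x = ψ m' x) :
    ∃ f : S.Space ≃ₜ S'.Space, (∀ m x, f (φ m x) = ψ m x) ∧ ∀ m x, f.symm (ψ m x) = φ m x := by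
  obtain ⟨f, hf, hfφ⟩ := h.exists_continuous h' fun m m' x => (hφψ m m' x).1
  obtain ⟨g, hg, hgψ⟩ := h'.exists_continuous h fun m m' x => (hφψ m m' x).2
  refine ⟨⟨⟨f, g, fun p => ?_, fun p => ?_⟩, hf, hg⟩, hfφ, hgψ⟩
  · obtain ⟨m, x, rfl⟩ := h.exists_eq p
    rw [hfφ, hgψ]
  · obtain ⟨m, x, rfl⟩ := h'.exists_eq p
    rw [hgψ, hfφ]

/-- In charts `f` is the identity, so on a simplex it is a relabeling of vertices into some simplex
`k` of `S'`. The passage from `k` to the prescribed simplex `j` is affine because `S'` is a complex.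
-/
theorem affineOnFaces (h : IsAtlas φ) (h' : IsAtlas ψ) {f : S.Space → S'.Space}
    (hf : ∀ m x, f (φ m x) = ψ m x) : AffineOnFaces S S' f := by
  intro i F j G hFG
  obtain ⟨m, τ, hτ, hm⟩ := h.exists_factor i
  obtain ⟨k, γ, hγ⟩ := h'.exists_param m
  have hk : ∀ x, f (S.ξ i x) = S'.ξ k (stdSimplex.map γ.symm (stdSimplex.map τ x)) := fun x => by
    rw [hm, hf, h'.eq_comp hγ]
  have hmap : ∀ x ∈ stdFace F, ∃ y ∈ stdFace G,
      S'.ξ j y = S'.ξ k (stdSimplex.map γ.symm (stdSimplex.map τ x)) := fun x hx => by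
    rw [← hk]
    have : f (S.ξ i x) ∈ S'.face j G := hFG ▸ mem_image_of_mem f (mem_image_of_mem _ hx)
    exact this
  obtain ⟨T, hT⟩ := h'.isComplex.affine k j ((F.image τ).image γ.symm) (by
    rw [← map_image_stdFace γ.symm.injective, ← map_image_stdFace hτ]
    rintro _ ⟨_, ⟨x, hx, rfl⟩, rfl⟩
    obtain ⟨y, -, hy⟩ := hmap x hx
    exact ⟨mem_range_self _, y, hy⟩)
  refine ⟨T.comp ((FunOnFinite.linearMap ℝ ℝ γ.symm).toAffineMap.comp
    (FunOnFinite.linearMap ℝ ℝ τ).toAffineMap), fun x hx => ?_⟩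
  obtain ⟨y, hy, hy'⟩ := hmap x hx
  obtain ⟨z, hz, hz'⟩ := hT (stdSimplex.map γ.symm (stdSimplex.map τ x)) (by
    rw [← map_image_stdFace γ.symm.injective, ← map_image_stdFace hτ]
    exact mem_image_of_mem _ (mem_image_of_mem _ hx))
  obtain rfl : z = y := (h'.isComplex.isEmbedding j).injective (hz'.trans hy'.symm)
  exact ⟨z, hy, hz, by rw [hz', hk]⟩

theorem image_image_eq {f : S.Space → S'.Space} (hf : ∀ m x, f (φ m x) = ψ m x) (m : M)
    (K : Set (stdSimplex ℝ (Fin (n + 1)))) : f '' (φ m '' K) = ψ m '' K := by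
  rw [← image_comp]
  exact image_congr fun x _ => hf m x

theorem isFace_image_of_map (h : IsAtlas φ) (h' : IsAtlas ψ) {f : S.Space → S'.Space}
    (hf : ∀ m x, f (φ m x) = ψ m x) {k : ℕ} {A : Set S.Space} (hA : S.IsFace k A) :
    S'.IsFace k (f '' A) := by
  obtain ⟨m, F, hF, rfl⟩ := (h.isFace_iff k A).1 hA
  rw [image_image_eq hf]
  exact h'.isFace_image m hF

theorem exists_vertex (h : IsAtlas φ) (v : S.Vertex) : ∃ m c, v.1 = φ m '' stdFace {c} := by
  obtain ⟨m, F, hF, hv⟩ := (h.isFace_iff 0 v.1).1 v.2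
  obtain ⟨c, rfl⟩ := Finset.card_eq_one.1 hF
  exact ⟨m, c, hv⟩

theorem exists_facet (h : IsAtlas φ) (A : S.Facet n) :
    ∃ m c, A.1 = φ m '' stdFace (Finset.univ.erase c) := by
  obtain ⟨k, hk, hA⟩ := A.2
  obtain ⟨m, F, hF, hA⟩ := (h.isFace_iff k A.1).1 hA
  have hc : (Fᶜ).card = 1 := by
    rw [Finset.card_compl, hF, Fintype.card_fin]
    omega
  obtain ⟨c, hc⟩ := Finset.card_eq_one.1 hc
  refine ⟨m, c, ?_⟩
  rw [hA, ← compl_compl F, hc, Finset.compl_singleton]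

/-- The facet opposite to a vertex of a chamber. -/
def facet (h : IsAtlas φ) (hn : 1 ≤ n) (m : M) (c : Fin (n + 1)) : S.Facet n :=
  ⟨φ m '' stdFace (Finset.univ.erase c), n - 1, by omega, h.isFace_image m (by
    rw [Finset.card_erase_of_mem (Finset.mem_univ c), Finset.card_univ, Fintype.card_fin]
    omega)⟩

end IsAtlas

end SimplexQuotient

/-! ### Colored atlases, isomorphisms and adjacency -/

namespace LabeledColoredPseudomanifold

open SimplexQuotient

variable {n L : ℕ}

/-- The simplices of an atlas indexed by signs and labels are the chambers with these signs and
labels, and their vertices and facets have the prescribed colors. -/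
structure IsColoredAtlas (P : LabeledColoredPseudomanifold n L)
    (φ : ℤˣ × Fin L → stdSimplex ℝ (Fin (n + 1)) → P.S.Space) : Prop where
  isAtlas : IsAtlas φ
  plus_eq : ∀ a, (P.labeling.plus a).1.1 = range (φ (1, a))
  minus_eq : ∀ a, (P.labeling.minus a).1.1 = range (φ (-1, a))
  vertexColor_eq : ∀ (v : P.S.Vertex) m c, v.1 = φ m '' stdFace {c} → P.coloring.vertexColor v = c
  facetColor_eq : ∀ (A : P.S.Facet n) m c, A.1 = φ m '' stdFace (Finset.univ.erase c) →
    P.coloring.facetColor A = c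

theorem IsColoredAtlas.sign_eq {P : LabeledColoredPseudomanifold n L}
    {φ : ℤˣ × Fin L → stdSimplex ℝ (Fin (n + 1)) → P.S.Space} (h : IsColoredAtlas P φ)
    (C : P.S.Chamber n) (m : ℤˣ × Fin L) (hC : C.1 = range (φ m)) :
    P.coloring.sign C = m.1 := by
  obtain ⟨s, a⟩ := m
  rcases Int.units_eq_one_or s with rfl | rfl
  · obtain rfl : C = (P.labeling.plus a).1 := Subtype.ext (hC.trans (h.plus_eq a).symm)
    exact (P.labeling.plus a).2
  · obtain rfl : C = (P.labeling.minus a).1 := Subtype.ext (hC.trans (h.minus_eq a).symm)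
    exact (P.labeling.minus a).2

/-- Faces, signs, colors and labels can all be read off the charts, and the homeomorphism carries
each chart to the corresponding one. -/
theorem IsColoredAtlas.nonempty_iso {P Q : LabeledColoredPseudomanifold n L}
    {φ : ℤˣ × Fin L → stdSimplex ℝ (Fin (n + 1)) → P.S.Space}
    {ψ : ℤˣ × Fin L → stdSimplex ℝ (Fin (n + 1)) → Q.S.Space}
    (h : IsColoredAtlas P φ) (h' : IsColoredAtlas Q ψ)
    (hφψ : ∀ m m' x, φ m x = φ m' x ↔ ψ m x = ψ m' x) : Nonempty (Iso P Q) := by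
  obtain ⟨f, hf, hf'⟩ := h.isAtlas.exists_homeomorph h'.isAtlas hφψ
  refine ⟨⟨f, fun k A => ⟨fun hA => h.isAtlas.isFace_image_of_map h'.isAtlas hf hA, fun hA => ?_⟩,
    h.isAtlas.affineOnFaces h'.isAtlas hf, h'.isAtlas.affineOnFaces h.isAtlas hf', ?_, ?_, ?_,
    ?_, ?_⟩⟩
  · have := h'.isAtlas.isFace_image_of_map h.isAtlas hf' hA
    rw [← image_comp] at this
    simpa using this
  · intro C D hD
    obtain ⟨m, hm⟩ := (h.isAtlas.isFace_chamber_iff C.1).1 C.2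
    rw [h.sign_eq C m hm, h'.sign_eq D m]
    rw [hD, hm, ← image_univ, IsAtlas.image_image_eq hf, image_univ]
  · intro v w hw
    obtain ⟨m, c, hm⟩ := h.isAtlas.exists_vertex v
    rw [h.vertexColor_eq v m c hm, h'.vertexColor_eq w m c]
    rw [hw, hm, IsAtlas.image_image_eq hf]
  · intro A B hB
    obtain ⟨m, c, hm⟩ := h.isAtlas.exists_facet A
    rw [h.facetColor_eq A m c hm, h'.facetColor_eq B m c]
    rw [hB, hm, IsAtlas.image_image_eq hf]
  · intro a
    rw [h.plus_eq, h'.plus_eq, ← image_univ, ← image_univ, IsAtlas.image_image_eq hf]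
  · intro a
    rw [h.minus_eq, h'.minus_eq, ← image_univ, ← image_univ, IsAtlas.image_image_eq hf]

/-- The plus-chamber with label `a` and the minus-chamber with label `b` share a facet of
color `c`. -/
def Adjacent (P : LabeledColoredPseudomanifold n L) (c : Fin (n + 1)) (a b : Fin L) : Prop :=
  ∃ A : P.S.Facet n, P.coloring.facetColor A = c ∧
    A.1 ⊆ (P.labeling.plus a).1.1 ∧ A.1 ⊆ (P.labeling.minus b).1.1

theorem Iso.adjacent {P Q : LabeledColoredPseudomanifold n L} (e : Iso P Q) {c : Fin (n + 1)}
    {a b : Fin L} (h : P.Adjacent c a b) : Q.Adjacent c a b := by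
  obtain ⟨A, hc, ha, hb⟩ := h
  obtain ⟨k, hk, hA⟩ := A.2
  let B : Q.S.Facet n := ⟨e.f '' A.1, k, hk, (e.isFace_iff k A.1).1 hA⟩
  refine ⟨B, (e.facetColor_eq A B rfl).trans hc, ?_, ?_⟩
  · rw [e.plus_eq]
    exact image_mono ha
  · rw [e.minus_eq]
    exact image_mono hb

theorem adjacent_iff_of_equiv {P Q : LabeledColoredPseudomanifold n L} (h : P ≈ Q)
    (c : Fin (n + 1)) (a b : Fin L) : P.Adjacent c a b ↔ Q.Adjacent c a b := by
  obtain ⟨e⟩ := h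
  obtain ⟨e'⟩ := iso_symm e
  exact ⟨e.adjacent, e'.adjacent⟩

theorem IsColoredAtlas.adjacent_iff {P : LabeledColoredPseudomanifold n L}
    {φ : ℤˣ × Fin L → stdSimplex ℝ (Fin (n + 1)) → P.S.Space} (h : IsColoredAtlas P φ)
    (hn : 1 ≤ n) (c : Fin (n + 1)) (a b : Fin L) :
    P.Adjacent c a b ↔ Agree φ (Finset.univ.erase c) (1, a) (-1, b) := by
  constructor
  · rintro ⟨A, hc, ha, hb⟩
    obtain ⟨m, d, hm⟩ := h.isAtlas.exists_facet A
    obtain rfl : d = c := (h.facetColor_eq A m d hm).symm.trans hc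
    rw [hm, h.plus_eq, h.isAtlas.image_subset_range_iff] at ha
    rw [hm, h.minus_eq, h.isAtlas.image_subset_range_iff] at hb
    exact fun z hz => (ha z hz).symm.trans (hb z hz)
  · intro ha
    refine ⟨h.isAtlas.facet hn (1, a) c, h.facetColor_eq _ (1, a) c rfl, ?_, ?_⟩
    · rw [h.plus_eq]
      exact image_subset_range _ _
    · rw [h.minus_eq]
      exact h.isAtlas.image_subset_range_iff.2 ha

end LabeledColoredPseudomanifold

/-! ### Links and galleries -/

namespace SimplexQuotient

section LinkSimplex

variable {n : ℕ} {F : Finset (Fin (n + 1))}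

theorem barycenter_mem_linkSimplex {v : Fin (n + 1)} (hv : v ∉ F) :
    ∃ x ∈ linkSimplex F, stdSupp x = insert v F := by
  obtain ⟨x, hx, hx'⟩ := exists_stdSupp_eq (Finset.insert_nonempty v F)
  exact ⟨x, subset_convexHull ℝ _ ⟨v, hv, hx⟩, hx'⟩

theorem isConnected_linkSimplex (hF : F ≠ Finset.univ) : IsConnected (linkSimplex F) := by
  have hv : ∃ v, v ∉ F := by
    by_contra! h
    exact hF (Finset.eq_univ_iff_forall.2 h)
  obtain ⟨v, hv⟩ := hv
  obtain ⟨x, hx, -⟩ := barycenter_mem_linkSimplex hv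
  refine ⟨⟨x, hx⟩, ?_⟩
  have hK := (convex_convexHull ℝ {b : Fin (n + 1) → ℝ | ∃ v, v ∉ F ∧
    b = faceBarycenter (insert v F)}).isPreconnected
  have himg : Subtype.val '' linkSimplex F = convexHull ℝ {b : Fin (n + 1) → ℝ | ∃ v, v ∉ F ∧
      b = faceBarycenter (insert v F)} := by
    apply Subset.antisymm
    · rintro _ ⟨x, hx, rfl⟩
      exact hx
    · intro y hy
      refine ⟨⟨y, ?_⟩, hy, rfl⟩
      refine convexHull_min ?_ (convex_stdSimplex ℝ _) hy
      rintro _ ⟨v, -, rfl⟩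
      exact faceBarycenter_mem (Finset.insert_nonempty v F)
  rw [← himg] at hK
  exact IsInducing.subtypeVal.isPreconnected_image.1 hK

theorem isClosed_linkSimplex (F : Finset (Fin (n + 1))) : IsClosed (linkSimplex F) := by
  have hfin : {b : Fin (n + 1) → ℝ | ∃ v, v ∉ F ∧ b = faceBarycenter (insert v F)}.Finite :=
    (finite_range fun v => faceBarycenter (insert v F)).subset (by
      rintro _ ⟨v, -, rfl⟩
      exact mem_range_self v)
  exact (hfin.isClosed_convexHull ℝ).preimage continuous_subtype_val

/-- At each of the barycenters, every coordinate in `F` is positive, and so is the sum of the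
coordinates outside `F`. These are half-space conditions, so they pass to the convex hull.
Strictness is what makes the induction on codimension advance. -/
theorem ssubset_stdSupp_of_mem_linkSimplex {x : stdSimplex ℝ (Fin (n + 1))}
    (hx : x ∈ linkSimplex F) : F ⊂ stdSupp x := by
  have hc : ∀ w : Fin (n + 1), ∀ G : Finset (Fin (n + 1)), w ∈ G → 0 < faceBarycenter G w := by
    intro w G hw
    rw [faceBarycenter, if_pos hw, inv_pos]
    exact_mod_cast Finset.card_pos.2 ⟨w, hw⟩
  have h0 : ∀ w : Fin (n + 1), ∀ G : Finset (Fin (n + 1)), 0 ≤ faceBarycenter G w := by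
    intro w G
    unfold faceBarycenter
    split_ifs <;> positivity
  refine Finset.ssubset_iff_subset_ne.2 ⟨fun w hw => mem_stdSupp.2 ?_, ?_⟩
  · have : x.1 ∈ {y : Fin (n + 1) → ℝ | 0 < LinearMap.proj (R := ℝ) (φ := fun _ => ℝ) w y} := by
      refine convexHull_min ?_ (convex_halfSpace_gt (LinearMap.isLinear _) 0) hx
      rintro _ ⟨v, -, rfl⟩
      exact hc w _ (Finset.mem_insert_of_mem hw)
    exact ne_of_gt this
  · intro hF
    have : x.1 ∈ {y : Fin (n + 1) → ℝ |
        0 < (∑ w ∈ Fᶜ, LinearMap.proj (R := ℝ) (φ := fun _ => ℝ) w) y} := by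
      refine convexHull_min ?_ (convex_halfSpace_gt (LinearMap.isLinear _) 0) hx
      rintro _ ⟨v, hv, rfl⟩
      change 0 < (∑ w ∈ Fᶜ, LinearMap.proj (R := ℝ) (φ := fun _ => ℝ) w) _
      rw [LinearMap.sum_apply]
      exact Finset.sum_pos' (fun w _ => h0 w _) ⟨v, by simpa using hv, hc v _ (by simp)⟩
    change 0 < (∑ w ∈ Fᶜ, LinearMap.proj (R := ℝ) (φ := fun _ => ℝ) w) _ at this
    rw [LinearMap.sum_apply, Finset.sum_eq_zero] at this
    · exact lt_irrefl _ this
    · intro w hw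
      exact mem_stdFace_stdSupp x w (hF ▸ Finset.mem_compl.1 hw)

end LinkSimplex

variable {S : SimplexQuotient} {n : ℕ} {M : Type}
  {φ : M → stdSimplex ℝ (Fin (n + 1)) → S.Space}

theorem Agree.mono {F G : Finset (Fin (n + 1))} {m m' : M} (h : Agree φ G m m') (hFG : F ⊆ G) :
    Agree φ F m m' := fun z hz => h z (stdFace_mono hFG hz)

theorem Agree.symm {F : Finset (Fin (n + 1))} {m m' : M} (h : Agree φ F m m') :
    Agree φ F m' m := fun z hz => (h z hz).symm

theorem Agree.trans {F : Finset (Fin (n + 1))} {m m' m'' : M} (h : Agree φ F m m')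
    (h' : Agree φ F m' m'') : Agree φ F m m'' := fun z hz => (h z hz).trans (h' z hz)

/-- Two chambers share a facet that contains the face spanned by `F`. -/
def FacetAdj (φ : M → stdSimplex ℝ (Fin (n + 1)) → S.Space) (F : Finset (Fin (n + 1)))
    (m m' : M) : Prop :=
  ∃ c ∉ F, Agree φ (Finset.univ.erase c) m m'

theorem FacetAdj.agree {F : Finset (Fin (n + 1))} {m m' : M} (h : FacetAdj φ F m m') :
    Agree φ F m m' := by
  obtain ⟨c, hc, h⟩ := h
  refine h.mono fun v hv => Finset.mem_erase.2 ⟨?_, Finset.mem_univ v⟩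
  rintro rfl
  exact hc hv

theorem FacetAdj.mono {F G : Finset (Fin (n + 1))} {m m' : M} (h : FacetAdj φ G m m')
    (hFG : F ⊆ G) : FacetAdj φ F m m' := by
  obtain ⟨c, hc, h⟩ := h
  exact ⟨c, fun h' => hc (hFG h'), h⟩

namespace IsAtlas

/-- The link is a union of connected pieces, one per chamber around the face. The pieces of two
chambers sharing the facet opposite to `c` meet in the barycenter of `insert v F` for any `v ∉ F`
other than `c`; codimension at least two provides such a `v`. -/
theorem isConnected_link (h : IsAtlas φ) {F : Finset (Fin (n + 1))} (hF : F.card + 1 ≤ n)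
    (hconn : ∀ m m', Agree φ F m m' → Relation.ReflTransGen (FacetAdj φ F) m m') (m : M) :
    IsConnected (S.link (φ m '' stdFace F)) := by
  have hcard : Finset.univ.card = n + 1 := Finset.card_fin (n + 1)
  rw [h.link_eq]
  refine IsConnected.biUnion_of_reflTransGen ⟨m, fun _ _ => rfl⟩ (fun m' _ => ?_)
    fun i hi j hj => ?_
  · refine (isConnected_linkSimplex ?_).image _ (h.continuous m').continuousOn
    rintro rfl
    omega
  · have hij := hconn i j (Agree.trans (Agree.symm hi) hj)
    clear hj
    induction hij with
    | refl => exact Relation.ReflTransGen.refl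
    | @tail k l hik hkl ih =>
      refine ih.tail ⟨?_, ?_⟩
      · obtain ⟨c, hc, hkl⟩ := hkl
        have hv : ∃ v, v ∉ insert c F := by
          by_contra! hall
          have := Finset.card_insert_le c F
          rw [Finset.eq_univ_iff_forall.2 hall] at this
          omega
        obtain ⟨v, hv⟩ := hv
        rw [Finset.mem_insert, not_or] at hv
        obtain ⟨x, hx, hx'⟩ := barycenter_mem_linkSimplex hv.2
        refine ⟨φ k x, mem_image_of_mem _ hx, x, hx, (hkl x ?_).symm⟩
        rw [mem_stdFace_iff, hx']
        intro u hu
        refine Finset.mem_erase.2 ⟨?_, Finset.mem_univ u⟩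
        rintro rfl
        rcases Finset.mem_insert.1 hu with h | h
        · exact hv.1 h.symm
        · exact hc h
      -- The gallery has to stay among the chambers that contain the face.
      · have : ∀ l, Relation.ReflTransGen (FacetAdj φ F) i l → Agree φ F i l := by
          intro l hl
          induction hl with
          | refl => exact fun _ _ => rfl
          | tail _ hkl ih => exact ih.trans hkl.agree
        exact Agree.trans hi (this k hik)

/-- In an atlas of a complex with connected links, chambers with a common face are connected by
a gallery of chambers with this face. -/
theorem reflTransGen_facetAdj [Finite M] (h : IsAtlas φ)
    (hlink : ∀ k, k + 2 ≤ n → ∀ Γ, S.IsFace k Γ → IsConnected (S.link Γ))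
    {F : Finset (Fin (n + 1))} (hF : F.Nonempty) {m m' : M} (hm : Agree φ F m m') :
    Relation.ReflTransGen (FacetAdj φ F) m m' := by
  have hcard : Finset.univ.card = n + 1 := Finset.card_fin (n + 1)
  induction hd : Fᶜ.card using Nat.strong_induction_on generalizing F m m' with
  | _ d ih =>
    rw [Finset.card_compl, Fintype.card_fin] at hd
    have hFle : F.card ≤ n + 1 := by simpa using F.card_le_univ
    -- With no vertex missing from `F` the chambers coincide; with one missing, `F` spans a facet,
    -- and a single crossing suffices.
    rcases Nat.lt_or_ge d 2 with hd2 | hd2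
    · interval_cases d
      · have : F = Finset.univ := (Finset.card_eq_iff_eq_univ F).1 (by simp; omega)
        rw [this] at hm
        rw [h.eq_of_agree _ _ hm]
      · have hc : (Fᶜ).card = 1 := by
          rw [Finset.card_compl, Fintype.card_fin, hd]
        obtain ⟨c, hc⟩ := Finset.card_eq_one.1 hc
        refine Relation.ReflTransGen.single ⟨c, ?_, ?_⟩
        · rw [← Finset.mem_compl, hc]
          exact Finset.mem_singleton_self c
        · rwa [← Finset.compl_singleton, ← hc, compl_compl]
    -- The pieces of the chambers reachable from `m` and those of the unreachable ones form two
    -- closed sets that cover the link and both meet it, so they have a common point there.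
    · by_contra hmm'
      have hpos := hF.card_pos
      have hconn := (hlink (F.card - 1) (by omega) _
        (h.isFace_image m (F := F) (by omega))).isPreconnected
      rw [h.link_eq, isPreconnected_closed_iff] at hconn
      have hv : ∃ v, v ∉ F := by
        by_contra! hall
        rw [Finset.eq_univ_iff_forall.2 hall] at hd
        omega
      obtain ⟨v, hv⟩ := hv
      obtain ⟨x, hx, -⟩ := barycenter_mem_linkSimplex hv
      have hcl : ∀ T : Set M, IsClosed (⋃ k ∈ T, φ k '' linkSimplex F) := fun T =>
        T.toFinite.isClosed_biUnion fun k _ => h.isClosed_image k (isClosed_linkSimplex F)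
      obtain ⟨p, -, hp, hp'⟩ := hconn _ _
        (hcl {k | Relation.ReflTransGen (FacetAdj φ F) m k})
        (hcl {k | ¬ Relation.ReflTransGen (FacetAdj φ F) m k})
        (by
          intro p hp
          simp only [mem_iUnion, exists_prop] at hp
          obtain ⟨k, -, hk⟩ := hp
          by_cases hmk : Relation.ReflTransGen (FacetAdj φ F) m k
          · exact Or.inl (mem_biUnion (show k ∈ {k | _} from hmk) hk)
          · exact Or.inr (mem_biUnion (show k ∈ {k | _} from hmk) hk))
        ⟨φ m x, mem_biUnion (show m ∈ {k | _} from fun _ _ => rfl) (mem_image_of_mem _ hx),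
          mem_biUnion (show m ∈ {k | _} from Relation.ReflTransGen.refl) (mem_image_of_mem _ hx)⟩
        ⟨φ m' x, mem_biUnion (show m' ∈ {k | _} from hm) (mem_image_of_mem _ hx),
          mem_biUnion (show m' ∈ {k | _} from hmm') (mem_image_of_mem _ hx)⟩
      simp only [mem_iUnion, exists_prop] at hp hp'
      obtain ⟨k, hk, y, hy, rfl⟩ := hp
      obtain ⟨l, hl, z, -, hzy⟩ := hp'
      obtain rfl := h.eq_of_eq _ _ _ _ hzy
      -- The chambers `k` and `l` share the smallest face containing the common point. It is
      -- strictly larger than `F`, so by induction a gallery joins them, and `l` is reachable after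
      -- all.
      have hss := ssubset_stdSupp_of_mem_linkSimplex hy
      have hkl := ih ((stdSupp z)ᶜ.card) (by
        rw [Finset.card_compl, Fintype.card_fin]
        have h1 := Finset.card_lt_card hss
        have h2 : (stdSupp z).card ≤ n + 1 := by simpa using (stdSupp z).card_le_univ
        omega) (stdSupp_nonempty z) (h.agree_of_eq _ _ _ hzy.symm) rfl
      exact hl (Relation.ReflTransGen.trans hk (Relation.ReflTransGen.mono (fun _ _ hab => hab.mono hss.subset) _ _ hkl))

end IsAtlas

end SimplexQuotient

/-! ### The glued space -/

open SimplexQuotient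

namespace Gluing

variable {n L : ℕ} {g : Fin (n + 1) → Equiv.Perm (Fin L)}

/-- A plus-simplex and a minus-simplex that are glued along a facet which contains the face
spanned by `F`. -/
def Adj (g : Fin (n + 1) → Equiv.Perm (Fin L)) (F : Finset (Fin (n + 1)))
    (m m' : ℤˣ × Fin L) : Prop :=
  ∃ c ∉ F, ∃ a, m = (1, a) ∧ m' = (-1, g c a)

/-- The equivalence relation generated by `Adj`. -/
def Linked (g : Fin (n + 1) → Equiv.Perm (Fin L)) (F : Finset (Fin (n + 1))) :
    ℤˣ × Fin L → ℤˣ × Fin L → Prop :=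
  Relation.EqvGen (Adj g F)

theorem Linked.mono {F G : Finset (Fin (n + 1))} (hFG : F ⊆ G) {m m' : ℤˣ × Fin L}
    (h : Linked g G m m') : Linked g F m m' :=
  Relation.EqvGen.mono (fun _ _ ⟨c, hc, ha⟩ => ⟨c, fun h => hc (hFG h), ha⟩) _ _ h

theorem Linked.eq {m m' : ℤˣ × Fin L} (h : Linked g Finset.univ m m') : m = m' := by
  induction h with
  | rel _ _ h => exact absurd (Finset.mem_univ _) h.choose_spec.1
  | refl => rfl
  | symm _ _ _ ih => exact ih.symm
  | trans _ _ _ _ _ ih ih' => exact ih.trans ih'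

/-- The simplex that is glued to a given one along the facet of color `c`. -/
def neighbor (g : Fin (n + 1) → Equiv.Perm (Fin L)) (c : Fin (n + 1)) (m : ℤˣ × Fin L) :
    ℤˣ × Fin L :=
  (-m.1, if m.1 = 1 then g c m.2 else (g c).symm m.2)

theorem neighbor_one (c : Fin (n + 1)) (a : Fin L) : neighbor g c (1, a) = (-1, g c a) := by
  simp [neighbor]

theorem neighbor_neg_one (c : Fin (n + 1)) (b : Fin L) :
    neighbor g c (-1, b) = (1, (g c).symm b) := by
  have : (-1 : ℤˣ) ≠ 1 := by decide
  simp [neighbor, this]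

theorem neighbor_neighbor (c : Fin (n + 1)) (m : ℤˣ × Fin L) :
    neighbor g c (neighbor g c m) = m := by
  obtain ⟨s, a⟩ := m
  rcases Int.units_eq_one_or s with rfl | rfl
  · rw [neighbor_one, neighbor_neg_one, Equiv.symm_apply_apply]
  · rw [neighbor_neg_one, neighbor_one, Equiv.apply_symm_apply]

theorem neighbor_ne (c : Fin (n + 1)) (m : ℤˣ × Fin L) : neighbor g c m ≠ m := by
  intro h
  exact neg_units_ne_self m.1 (congrArg Prod.fst h)

theorem linked_neighbor (c : Fin (n + 1)) (m : ℤˣ × Fin L) :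
    Linked g (Finset.univ.erase c) m (neighbor g c m) := by
  obtain ⟨s, a⟩ := m
  have hc : c ∉ Finset.univ.erase c := by simp
  rcases Int.units_eq_one_or s with rfl | rfl
  · rw [neighbor_one]
    exact Relation.EqvGen.rel _ _ ⟨c, hc, a, rfl, rfl⟩
  · rw [neighbor_neg_one]
    exact Relation.EqvGen.symm _ _ (Relation.EqvGen.rel _ _ ⟨c, hc, _, rfl, by simp⟩)

/-- Only crossings of color `c` are allowed, and crossing twice returns to the start. -/
theorem linked_erase_iff {c : Fin (n + 1)} {m m' : ℤˣ × Fin L} :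
    Linked g (Finset.univ.erase c) m m' ↔ m' = m ∨ m' = neighbor g c m := by
  constructor
  · intro h
    induction h with
    | rel _ _ h =>
      obtain ⟨d, hd, a, rfl, rfl⟩ := h
      obtain rfl : d = c := by simpa using hd
      exact Or.inr (neighbor_one d a).symm
    | refl => exact Or.inl rfl
    | symm _ _ _ ih =>
      rcases ih with h | h
      · exact Or.inl h.symm
      · exact Or.inr (by rw [h, neighbor_neighbor])
    | trans _ _ _ _ _ ih ih' =>
      rcases ih with rfl | rfl
      · exact ih'
      · rcases ih' with rfl | rfl
        · exact Or.inr rfl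
        · exact Or.inl (neighbor_neighbor _ _)
  · rintro (rfl | rfl)
    · exact Relation.EqvGen.refl _
    · exact linked_neighbor c m

/-- The tautological map of a simplex into the glued space. -/
def chart (g : Fin (n + 1) → Equiv.Perm (Fin L)) (m : ℤˣ × Fin L)
    (x : stdSimplex ℝ (Fin (n + 1))) : (gluing g).Space :=
  (gluing g).ξ m x

/-- Each gluing preserves coordinates, and the one of color `c` applies to `x` exactly when `c` is
not in the support of `x`. So the generated relation on points reduces to the relation on simplices
generated by the colors outside the support. -/
theorem chart_eq_iff {m m' : ℤˣ × Fin L} {x y : stdSimplex ℝ (Fin (n + 1))} :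
    chart g m x = chart g m' y ↔ x = y ∧ Linked g (stdSupp x) m m' := by
  have key : ∀ p q, Relation.EqvGen (GlueStep g) p q →
      p.2 = q.2 ∧ Linked g (stdSupp p.2) p.1 q.1 := by
    intro p q h
    induction h with
    | rel _ _ h =>
      obtain ⟨c, a, x, hx⟩ := h
      exact ⟨rfl, Relation.EqvGen.rel _ _ ⟨c, fun h => mem_stdSupp.1 h hx, a, rfl, rfl⟩⟩
    | refl => exact ⟨rfl, Relation.EqvGen.refl _⟩
    | symm _ _ _ ih => exact ⟨ih.1.symm, ih.1 ▸ Relation.EqvGen.symm _ _ ih.2⟩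
    | trans _ _ _ _ _ ih ih' =>
      refine ⟨ih.1.trans ih'.1, Relation.EqvGen.trans _ _ _ ih.2 ?_⟩
      rw [ih.1]
      exact ih'.2
  constructor
  · intro h
    exact key _ _ (Quotient.exact h)
  · rintro ⟨rfl, h⟩
    induction h with
    | rel _ _ h =>
      obtain ⟨c, hc, a, rfl, rfl⟩ := h
      refine Quotient.sound (Relation.EqvGen.rel _ _ (GlueStep.glue c a x ?_))
      by_contra hx
      exact hc (mem_stdSupp.2 hx)
    | refl => rfl
    | symm _ _ _ ih => exact ih.symm
    | trans _ _ _ _ _ ih ih' => exact ih.trans ih'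

/-- A single point with support exactly `F` detects linkedness; it exists because `F` is nonempty.
-/
theorem agree_iff {F : Finset (Fin (n + 1))} (hF : F.Nonempty) {m m' : ℤˣ × Fin L} :
    Agree (chart g) F m m' ↔ Linked g F m m' := by
  constructor
  · intro h
    obtain ⟨x, -, rfl⟩ := exists_stdSupp_eq hF
    exact (chart_eq_iff.1 (h x (mem_stdFace_stdSupp x))).2
  · intro h z hz
    exact chart_eq_iff.2 ⟨rfl, h.mono (mem_stdFace_iff.1 hz)⟩

/-- Since gluings preserve coordinates, these descend to a continuous map on the glued space, which
is a left inverse of every chart. -/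
theorem isEmbedding_chart (m : ℤˣ × Fin L) : IsEmbedding (chart g m) := by
  let r : (gluing g).Space → stdSimplex ℝ (Fin (n + 1)) :=
    Quotient.lift (fun p : Σ _ : ℤˣ × Fin L, stdSimplex ℝ (Fin (n + 1)) => p.2) fun p q h =>
      (chart_eq_iff.1 (Quotient.sound h : chart g p.1 p.2 = chart g q.1 q.2)).1
  have hr : Continuous r := Continuous.quotient_lift (continuous_sigma fun _ => continuous_id) _
  have hrm : r ∘ chart g m = id := rfl
  exact IsEmbedding.of_comp (continuous_ξ (S := gluing g) m) hr (hrm ▸ IsEmbedding.id)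

theorem preimage_range_chart (m m' : ℤˣ × Fin L) :
    chart g m ⁻¹' (range (chart g m) ∩ range (chart g m'))
      = ⋃ F ∈ {F : Finset (Fin (n + 1)) | Linked g F m m'}, stdFace F := by
  ext x
  simp only [mem_iUnion, exists_prop, mem_preimage]
  constructor
  · rintro ⟨-, y, hy⟩
    have := chart_eq_iff.1 hy.symm
    exact ⟨stdSupp x, this.2, mem_stdFace_stdSupp x⟩
  · rintro ⟨F, hF, hx⟩
    exact ⟨mem_range_self x, x,
      (chart_eq_iff.2 ⟨rfl, Linked.mono (mem_stdFace_iff.1 hx) hF⟩).symm⟩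

theorem isSimplicialCellComplex (g : Fin (n + 1) → Equiv.Perm (Fin L)) :
    (gluing g).IsSimplicialCellComplex where
  isEmbedding := isEmbedding_chart
  inter_eq_iUnion m m' := ⟨_, preimage_range_chart m m'⟩
  affine m m' F hF := by
    refine ⟨AffineMap.id ℝ (Fin (n + 1) → ℝ), fun x hx => ⟨x, rfl, ?_⟩⟩
    obtain ⟨-, y, hy⟩ := hF hx
    change chart g m' y = chart g m x at hy
    obtain ⟨rfl, -⟩ := chart_eq_iff.1 hy
    exact hy

theorem isAtlas (g : Fin (n + 1) → Equiv.Perm (Fin L)) : IsAtlas (chart g) where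
  isComplex := isSimplicialCellComplex g
  eq_of_eq _ _ _ _ h := (chart_eq_iff.1 h).1
  agree_of_eq _ _ x h := (agree_iff (stdSupp_nonempty x)).2 (chart_eq_iff.1 h).2
  exists_factor m := ⟨m, (id : Fin (n + 1) → Fin (n + 1)), Function.injective_id, fun x => by
    exact congrArg (chart g m) (stdSimplex.map_id_apply (S := ℝ) (X := Fin (n + 1)) x).symm⟩
  exists_param m := ⟨m, Equiv.refl (Fin (n + 1)), fun x => by
    exact congrArg (chart g m) (stdSimplex.map_id_apply (S := ℝ) (X := Fin (n + 1)) x).symm⟩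
  eq_of_agree _ _ h := ((agree_iff Finset.univ_nonempty).1 h).eq

theorem erase_nonempty (hn : 1 ≤ n) (c : Fin (n + 1)) : (Finset.univ.erase c).Nonempty := by
  rw [← Finset.card_pos, Finset.card_erase_of_mem (Finset.mem_univ c), Finset.card_fin]
  omega

theorem agree_erase_iff (hn : 1 ≤ n) {c : Fin (n + 1)} {m m' : ℤˣ × Fin L} :
    Agree (chart g) (Finset.univ.erase c) m m' ↔ m' = m ∨ m' = neighbor g c m := by
  rw [agree_iff (erase_nonempty hn c), linked_erase_iff]

theorem reflTransGen_of_linked {F : Finset (Fin (n + 1))} {m m' : ℤˣ × Fin L} {r}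
    (hr : ∀ m m', Adj g F m m' → r m m') (hr' : ∀ m m', r m m' → r m' m)
    (h : Linked g F m m') : Relation.ReflTransGen r m m' := by
  induction h with
  | rel _ _ h => exact Relation.ReflTransGen.single (hr _ _ h)
  | refl => exact Relation.ReflTransGen.refl
  | symm _ _ _ ih =>
    have : Std.Symm r := ⟨hr'⟩
    exact Relation.ReflTransGen.stdSymm.symm _ _ ih
  | trans _ _ _ _ _ ih ih' => exact ih.trans ih'

/-- The facet of color `c` of a simplex lies in this simplex and its `neighbor` only. Simplices with
a common face are linked by construction, which supplies the galleries that `isConnected_link` asks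
for. -/
theorem isNormalPseudomanifold (g : Fin (n + 1) → Equiv.Perm (Fin L)) :
    (gluing g).IsNormalPseudomanifold n where
  isPseudomanifold :=
    { isSimplicialCellComplex := isSimplicialCellComplex g
      exists_chamber := by
        rintro k A ⟨m, F, -, rfl⟩
        exact ⟨range (chart g m), ((isAtlas g).isFace_chamber_iff _).2 ⟨m, rfl⟩,
          image_subset_range _ _⟩
      two_chambers := by
        intro k hk A hA
        obtain ⟨m, c, hA⟩ := (isAtlas g).exists_facet ⟨A, k, hk, hA⟩
        obtain rfl : A = chart g m '' stdFace (Finset.univ.erase c) := hA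
        have : {C | (gluing g).IsFace n C ∧ chart g m '' stdFace (Finset.univ.erase c) ⊆ C}
            = {range (chart g m), range (chart g (neighbor g c m))} := by
          ext C
          constructor
          · rintro ⟨hC, hsub⟩
            obtain ⟨m', rfl⟩ := ((isAtlas g).isFace_chamber_iff _).1 hC
            rw [(isAtlas g).image_subset_range_iff, agree_erase_iff (by omega)] at hsub
            rcases hsub with rfl | rfl
            · exact Or.inl rfl
            · exact Or.inr rfl
          · have key : ∀ m', m' = m ∨ m' = neighbor g c m → (gluing g).IsFace n (range (chart g m'))
                ∧ chart g m '' stdFace (Finset.univ.erase c) ⊆ range (chart g m') := by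
              intro m' hm'
              refine ⟨((isAtlas g).isFace_chamber_iff _).2 ⟨m', rfl⟩, ?_⟩
              rwa [(isAtlas g).image_subset_range_iff, agree_erase_iff (by omega)]
            rintro (rfl | rfl)
            · exact key m (Or.inl rfl)
            · exact key _ (Or.inr rfl)
        rw [this, ncard_pair]
        rw [Ne, (isAtlas g).range_eq_iff]
        exact (neighbor_ne c m).symm }
  link_connected := by
    intro k hk Γ hΓ
    obtain ⟨m, F, hF, rfl⟩ := ((isAtlas g).isFace_iff k Γ).1 hΓ
    refine (isAtlas g).isConnected_link (by omega) (fun i j hij => ?_) m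
    rw [agree_iff (Finset.card_pos.1 (by omega))] at hij
    refine reflTransGen_of_linked ?_ (fun _ _ ⟨c, hc, h⟩ => ⟨c, hc, h.symm⟩) hij
    rintro _ _ ⟨c, hc, a, rfl, rfl⟩
    refine ⟨c, hc, (agree_erase_iff (by omega)).2 (Or.inr ?_)⟩
    rw [neighbor_one]

theorem exists_chamber (C : (gluing g).Chamber n) : ∃ m, C.1 = range (chart g m) :=
  ((isAtlas g).isFace_chamber_iff C.1).1 C.2

/-- The chamber that is the image of a given simplex. -/
def chamber (g : Fin (n + 1) → Equiv.Perm (Fin L)) (m : ℤˣ × Fin L) : (gluing g).Chamber n :=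
  ⟨range (chart g m), ((isAtlas g).isFace_chamber_iff _).2 ⟨m, rfl⟩⟩

/-- The sign of a chamber is the sign of the simplex it comes from. -/
noncomputable def sign (C : (gluing g).Chamber n) : ℤˣ := (exists_chamber C).choose.1

theorem sign_eq {C : (gluing g).Chamber n} {m : ℤˣ × Fin L} (h : C.1 = range (chart g m)) :
    sign C = m.1 := by
  rw [(exists_chamber C).choose_spec, (isAtlas g).range_eq_iff] at h
  exact congrArg Prod.fst h

/-- The color of a vertex is the color it has in any of the simplices. -/
noncomputable def vertexColor (v : (gluing g).Vertex) : Fin (n + 1) :=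
  ((isAtlas g).exists_vertex v).choose_spec.choose

theorem vertexColor_eq {v : (gluing g).Vertex} {m : ℤˣ × Fin L} {c : Fin (n + 1)}
    (h : v.1 = chart g m '' stdFace {c}) : vertexColor v = c := by
  rw [((isAtlas g).exists_vertex v).choose_spec.choose_spec, (isAtlas g).image_eq_iff] at h
  exact Finset.singleton_injective h.1

/-- The color of a facet is the color of the opposite vertices. -/
noncomputable def facetColor (A : (gluing g).Facet n) : Fin (n + 1) :=
  ((isAtlas g).exists_facet A).choose_spec.choose

theorem facetColor_eq {A : (gluing g).Facet n} {m : ℤˣ × Fin L} {c : Fin (n + 1)}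
    (h : A.1 = chart g m '' stdFace (Finset.univ.erase c)) : facetColor A = c := by
  rw [((isAtlas g).exists_facet A).choose_spec.choose_spec, (isAtlas g).image_eq_iff] at h
  have h1 := h.1
  rw [← Finset.compl_singleton, ← Finset.compl_singleton, compl_inj_iff] at h1
  exact Finset.singleton_injective h1

theorem exists_vertex_of_subset {C : (gluing g).Chamber n} {v : (gluing g).Vertex}
    {m : ℤˣ × Fin L} (hC : C.1 = range (chart g m)) (hv : v.1 ⊆ C.1) :
    v.1 = chart g m '' stdFace {vertexColor v} := by
  obtain ⟨m', c, hm'⟩ := (isAtlas g).exists_vertex v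
  rw [vertexColor_eq hm', hm', (isAtlas g).image_eq_iff]
  rw [hC, hm', (isAtlas g).image_subset_range_iff] at hv
  exact ⟨rfl, hv⟩

theorem exists_facet_of_subset {C : (gluing g).Chamber n} {A : (gluing g).Facet n}
    {m : ℤˣ × Fin L} (hC : C.1 = range (chart g m)) (hA : A.1 ⊆ C.1) :
    A.1 = chart g m '' stdFace (Finset.univ.erase (facetColor A)) := by
  obtain ⟨m', c, hm'⟩ := (isAtlas g).exists_facet A
  rw [facetColor_eq hm', hm', (isAtlas g).image_eq_iff]
  rw [hC, hm', (isAtlas g).image_subset_range_iff] at hA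
  exact ⟨rfl, hA⟩

/-- The coloring of the glued space. -/
noncomputable def coloring (g : Fin (n + 1) → Equiv.Perm (Fin L)) (hn : 1 ≤ n) :
    (gluing g).Coloring n where
  sign := sign
  vertexColor := vertexColor
  facetColor := facetColor
  sign_adjacent C D A hCD hAC hAD := by
    obtain ⟨m, hm⟩ := exists_chamber C
    obtain ⟨m', hm'⟩ := exists_chamber D
    rw [sign_eq hm, sign_eq hm']
    rw [exists_facet_of_subset hm hAC, hm', (isAtlas g).image_subset_range_iff,
      agree_erase_iff hn] at hAD
    rcases hAD with rfl | rfl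
    · exact absurd (Subtype.ext (hm.trans hm'.symm)) hCD
    · rfl
  vertexColor_ne C v w hv hw hvw h := by
    obtain ⟨m, hm⟩ := exists_chamber C
    refine hvw (Subtype.ext ?_)
    rw [exists_vertex_of_subset hm hv, exists_vertex_of_subset hm hw, h]
  facetColor_ne C A B hA hB hAB h := by
    obtain ⟨m, hm⟩ := exists_chamber C
    refine hAB (Subtype.ext ?_)
    rw [exists_facet_of_subset hm hA, exists_facet_of_subset hm hB, h]
  facetColor_eq C A v hA hv hvA := by
    obtain ⟨m, hm⟩ := exists_chamber C
    by_contra hne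
    apply hvA
    rw [exists_facet_of_subset hm hA, exists_vertex_of_subset hm hv]
    refine image_mono (stdFace_mono ?_)
    rw [Finset.singleton_subset_iff, Finset.mem_erase]
    exact ⟨Ne.symm hne, Finset.mem_univ _⟩

/-- The numbering of the chambers of a given sign. -/
noncomputable def labelEquiv (g : Fin (n + 1) → Equiv.Perm (Fin L)) (s : ℤˣ) :
    Fin L ≃ {C : (gluing g).Chamber n // sign C = s} :=
  Equiv.ofBijective (fun a => ⟨chamber g (s, a), sign_eq (m := (s, a)) rfl⟩) (by
    constructor
    · intro a b h
      have h1 : range (chart g (s, a)) = range (chart g (s, b)) :=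
        congrArg (fun C => C.1.1) h
      exact congrArg Prod.snd ((isAtlas g).range_eq_iff.1 h1)
    · rintro ⟨C, rfl⟩
      obtain ⟨m, hm⟩ := exists_chamber C
      exact ⟨m.2, Subtype.ext (Subtype.ext (by rw [hm, sign_eq hm]; rfl))⟩)

/-- The labeling of the glued space. -/
noncomputable def labeling (g : Fin (n + 1) → Equiv.Perm (Fin L)) (hn : 1 ≤ n) :
    Labeling (coloring g hn) L where
  plus := labelEquiv g 1
  minus := labelEquiv g (-1)

/-- The glued space as a labeled colored pseudomanifold. -/
noncomputable def pseudomanifold (g : Fin (n + 1) → Equiv.Perm (Fin L)) (hn : 1 ≤ n) :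
    LabeledColoredPseudomanifold n L :=
  ⟨gluing g, isNormalPseudomanifold g, coloring g hn, labeling g hn⟩

theorem isStandardLabeling (g : Fin (n + 1) → Equiv.Perm (Fin L)) (hn : 1 ≤ n) :
    IsStandardLabeling g (coloring g hn) (labeling g hn) where
  plus_eq _ := rfl
  minus_eq _ := rfl
  vertexColor_eq _ _ _ h := vertexColor_eq h
  facetColor_eq _ _ _ h := facetColor_eq h

theorem isColoredAtlas (g : Fin (n + 1) → Equiv.Perm (Fin L)) (hn : 1 ≤ n) :
    (pseudomanifold g hn).IsColoredAtlas (chart g) where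
  isAtlas := isAtlas g
  plus_eq _ := rfl
  minus_eq _ := rfl
  vertexColor_eq _ _ _ h := vertexColor_eq h
  facetColor_eq _ _ _ h := facetColor_eq h

theorem adjacent_iff (g : Fin (n + 1) → Equiv.Perm (Fin L)) (hn : 1 ≤ n) (c : Fin (n + 1))
    (a b : Fin L) : (pseudomanifold g hn).Adjacent c a b ↔ g c a = b := by
  rw [(isColoredAtlas g hn).adjacent_iff hn]
  refine (agree_erase_iff (g := g) hn).trans ?_
  simp [neighbor_one, eq_comm]

end Gluing

/-! ### The colored atlas of a labeled colored pseudomanifold -/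

namespace LabeledColoredPseudomanifold

open SimplexQuotient

variable {n L : ℕ} (P : LabeledColoredPseudomanifold n L)

theorem isComplex : P.S.IsSimplicialCellComplex :=
  P.isNormal.isPseudomanifold.isSimplicialCellComplex

/-- A vertex of one of the simplices, as a vertex of the complex. -/
def vertexAt (i : P.S.ι) (v : Fin (P.S.dim i + 1)) : P.S.Vertex :=
  ⟨P.S.face i {v}, i, {v}, rfl, rfl⟩

/-- The color of a vertex of one of the simplices. -/
def color (i : P.S.ι) (v : Fin (P.S.dim i + 1)) : Fin (n + 1) :=
  P.coloring.vertexColor (P.vertexAt i v)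

theorem color_eq_of_eq (i j : P.S.ι) (v : Fin (P.S.dim i + 1)) (u : Fin (P.S.dim j + 1))
    (h : P.S.ξ i (stdSimplex.vertex v) = P.S.ξ j (stdSimplex.vertex u)) :
    P.color i v = P.color j u := by
  refine congrArg P.coloring.vertexColor (Subtype.ext ?_)
  change P.S.face i {v} = P.S.face j {u}
  rw [face_singleton, face_singleton, h]

theorem exists_chamber_range (i : P.S.ι) :
    ∃ C : P.S.Chamber n, range (P.S.ξ i) ⊆ C.1 := by
  obtain ⟨C, hC, hi⟩ := P.isNormal.isPseudomanifold.exists_chamber (P.S.dim i)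
    (P.S.face i Finset.univ) ⟨i, Finset.univ, by simp, rfl⟩
  exact ⟨⟨C, hC⟩, by rwa [face_univ] at hi⟩

theorem color_injective (i : P.S.ι) : Function.Injective (P.color i) := by
  intro v w h
  by_contra hvw
  obtain ⟨C, hC⟩ := P.exists_chamber_range i
  refine P.coloring.vertexColor_ne C (P.vertexAt i v) (P.vertexAt i w)
    ((image_subset_range _ _).trans hC) ((image_subset_range _ _).trans hC) (fun h' => hvw ?_) h
  have h1 : P.S.face i {v} = P.S.face i {w} := congrArg Subtype.val h'
  rw [face_singleton, face_singleton, singleton_eq_singleton_iff] at h1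
  exact stdSimplex.vertex_injective ((P.isComplex.isEmbedding i).injective h1)

/-- A priori a chamber is an `n`-face of a possibly larger simplex. That simplex lies in some
chamber, so by counting vertices it has dimension at most `n`, and the face is all of it. -/
theorem exists_chamber_eq_range (C : P.S.Chamber n) :
    ∃ i, P.S.dim i = n ∧ C.1 = range (P.S.ξ i) := by
  obtain ⟨i, F, hF, hC⟩ := C.2
  obtain ⟨⟨D, j, G, hG, rfl⟩, hD⟩ := P.exists_chamber_range i
  rw [← face_univ] at hD
  have h1 := P.isComplex.card_le_of_face_subset hD
  have h2 := F.card_le_univ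
  rw [Finset.card_fin] at h1
  rw [Fintype.card_fin] at h2
  refine ⟨i, by omega, ?_⟩
  have hFu : F = Finset.univ := (Finset.card_eq_iff_eq_univ F).1 (by rw [Fintype.card_fin]; omega)
  rw [hC, hFu, face_univ]

/-- The chamber with a given sign and label. -/
def chamber (m : ℤˣ × Fin L) : P.S.Chamber n :=
  if m.1 = 1 then (P.labeling.plus m.2).1 else (P.labeling.minus m.2).1

theorem chamber_one (a : Fin L) : P.chamber (1, a) = (P.labeling.plus a).1 := if_pos rfl

theorem chamber_neg_one (a : Fin L) : P.chamber (-1, a) = (P.labeling.minus a).1 :=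
  if_neg (show ¬ (-1 : ℤˣ) = 1 by decide)

theorem sign_chamber (m : ℤˣ × Fin L) : P.coloring.sign (P.chamber m) = m.1 := by
  obtain ⟨s, a⟩ := m
  rcases Int.units_eq_one_or s with rfl | rfl
  · rw [chamber_one]
    exact (P.labeling.plus a).2
  · rw [chamber_neg_one]
    exact (P.labeling.minus a).2

theorem chamber_injective : Function.Injective P.chamber := by
  intro m m' h
  have hs : m.1 = m'.1 := by rw [← sign_chamber, h, sign_chamber]
  obtain ⟨s, a⟩ := m
  obtain ⟨s', a'⟩ := m'
  obtain rfl : s = s' := hs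
  rcases Int.units_eq_one_or s with rfl | rfl
  · rw [chamber_one, chamber_one] at h
    rw [P.labeling.plus.injective (Subtype.ext h)]
  · rw [chamber_neg_one, chamber_neg_one] at h
    rw [P.labeling.minus.injective (Subtype.ext h)]

theorem chamber_surjective : Function.Surjective P.chamber := by
  intro C
  rcases Int.units_eq_one_or (P.coloring.sign C) with h | h
  · exact ⟨(1, P.labeling.plus.symm ⟨C, h⟩), by rw [chamber_one, Equiv.apply_symm_apply]⟩
  · exact ⟨(-1, P.labeling.minus.symm ⟨C, h⟩), by rw [chamber_neg_one, Equiv.apply_symm_apply]⟩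

theorem exists_color_equiv (m : ℤˣ × Fin L) :
    ∃ (i : P.S.ι) (e : Fin (P.S.dim i + 1) ≃ Fin (n + 1)),
      (P.chamber m).1 = range (P.S.ξ i) ∧ ⇑e = P.color i := by
  obtain ⟨i, hi, hC⟩ := P.exists_chamber_eq_range (P.chamber m)
  exact ⟨i, Equiv.ofBijective (P.color i) ((Fintype.bijective_iff_injective_and_card _).2
    ⟨P.color_injective i, by rw [hi]⟩), hC, rfl⟩

/-- The simplices of a labeled colored pseudomanifold, with vertices indexed by the colors. -/
theorem exists_isColoredAtlas : ∃ φ : ℤˣ × Fin L → stdSimplex ℝ (Fin (n + 1)) → P.S.Space,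
    P.IsColoredAtlas φ := by
  choose i e hC he using P.exists_color_equiv
  let φ : ℤˣ × Fin L → stdSimplex ℝ (Fin (n + 1)) → P.S.Space :=
    fun m x => P.S.ξ (i m) (stdSimplex.map (e m).symm x)
  have hφ : ∀ m x, P.S.ξ (i m) x = φ m (stdSimplex.map (e m) x) := fun m x =>
    congrArg (P.S.ξ (i m)) ((stdSimplexCongr (e m)).symm_apply_apply x).symm
  have hsymm : ∀ m x, stdSimplex.map (S := ℝ) (P.color (i m)) (stdSimplex.map (e m).symm x) = x :=
    fun m x => by
      rw [← he]
      exact (stdSimplexCongr (e m)).apply_symm_apply x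
  have hrange : ∀ m, (P.chamber m).1 = range (φ m) := by
    intro m
    rw [hC]
    ext p
    constructor
    · rintro ⟨x, rfl⟩
      exact ⟨_, (hφ m x).symm⟩
    · rintro ⟨x, rfl⟩
      exact ⟨_, rfl⟩
  have hatlas : IsAtlas φ := by
    refine ⟨P.isComplex, ?_, ?_, ?_, fun m => ⟨i m, e m, hφ m⟩, ?_⟩
    · intro m m' x y h
      -- Identified points have equal color coordinates, and in the charts `φ` these are the
      -- coordinates themselves.
      obtain ⟨w, hw, hw'⟩ := P.isComplex.exists_map_eq P.color_eq_of_eq h (mem_stdFace_stdSupp _)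
      rw [(P.isComplex.isEmbedding _).injective (hw.trans h), hsymm, hsymm] at hw'
      exact hw'.symm
    · intro m m' x h z hz
      obtain ⟨w, hw, hw'⟩ := P.isComplex.exists_map_eq P.color_eq_of_eq h
        (z := stdSimplex.map (e m).symm z) (by
          rw [stdSupp_map (e m).symm.injective, ← map_image_stdFace (e m).symm.injective]
          exact mem_image_of_mem _ hz)
      rw [hsymm, ← he] at hw'
      change P.S.ξ (i m) _ = φ m' z
      rw [← hw, hφ, hw']
    -- The simplex `j` lies in some chamber; comparing color coordinates shows that its inclusion
    -- there is induced by the colors of its vertices.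
    · intro j
      obtain ⟨C, hj⟩ := P.exists_chamber_range j
      obtain ⟨m, rfl⟩ := P.chamber_surjective C
      refine ⟨m, P.color j, P.color_injective j, fun x => ?_⟩
      rw [hC] at hj
      obtain ⟨y, hy⟩ := hj (mem_range_self x)
      obtain ⟨w, hw, hw'⟩ := P.isComplex.exists_map_eq P.color_eq_of_eq hy.symm
        (mem_stdFace_stdSupp x)
      rw [← hw, ← hw', hφ, he]
    · intro m m' h
      refine P.chamber_injective (Subtype.ext ?_)
      rw [hrange, hrange]
      congr 1
      funext x
      exact h x (stdFace_univ ▸ mem_univ x)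
  have hvertex : ∀ (v : P.S.Vertex) m c, v.1 = φ m '' stdFace {c} →
      P.coloring.vertexColor v = c := by
    intro v m c hv
    have h1 : v = P.vertexAt (i m) ((e m).symm c) := by
      refine Subtype.ext (hv.trans ?_)
      change _ = P.S.face (i m) _
      rw [IsAtlas.face_eq (e m).injective (hφ m), Finset.image_singleton, Equiv.apply_symm_apply]
    rw [h1]
    change P.color _ _ = c
    rw [← he, Equiv.apply_symm_apply]
  refine ⟨φ, hatlas, fun a => ?_, fun a => ?_, hvertex, fun A m c hA => ?_⟩
  · rw [← hrange, chamber_one]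
  · rw [← hrange, chamber_neg_one]
  -- The coloring axioms determine the color of a facet through the opposite vertex, here the vertex
  -- of color `c` in the chart `m`.
  · let v : P.S.Vertex := ⟨φ m '' stdFace {c}, hatlas.isFace_image m (Finset.card_singleton c)⟩
    rw [← hvertex v m c rfl]
    refine P.coloring.facetColor_eq (P.chamber m) A v ?_ ?_ ?_
    · rw [hA, hrange]
      exact image_subset_range _ _
    · rw [hrange]
      exact image_subset_range _ _
    · rw [hA]
      intro h
      simpa using (hatlas.image_subset_iff.1 h).1

/-! ### Recovering the permutations and the gluing -/

variable {P}

/-- The facet lies in exactly two chambers, and the second one has the opposite sign, so only its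
label `b` is left to be found. -/
theorem IsColoredAtlas.exists_neighbor {φ : ℤˣ × Fin L → stdSimplex ℝ (Fin (n + 1)) → P.S.Space}
    (h : IsColoredAtlas P φ) (hn : 1 ≤ n) (c : Fin (n + 1)) (m : ℤˣ × Fin L) :
    ∃ b, ∀ m', Agree φ (Finset.univ.erase c) m m' ↔ m' = m ∨ m' = (-m.1, b) := by
  let A := h.isAtlas.facet hn m c
  obtain ⟨k, hk, hA⟩ := A.2
  have htwo := P.isNormal.isPseudomanifold.two_chambers k hk A.1 hA
  have hmem : ∀ m', range (φ m') ∈ {C | P.S.IsFace n C ∧ A.1 ⊆ C} ↔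
      Agree φ (Finset.univ.erase c) m m' := by
    intro m'
    rw [← h.isAtlas.image_subset_range_iff]
    exact ⟨fun h => h.2, fun h' => ⟨(h.isAtlas.isFace_chamber_iff _).2 ⟨m', rfl⟩, h'⟩⟩
  have hm : Agree φ (Finset.univ.erase c) m m := fun _ _ => rfl
  obtain ⟨D, hD, hDm⟩ := exists_ne_of_one_lt_ncard (htwo ▸ one_lt_two) (range (φ m))
  obtain ⟨m', rfl⟩ := (h.isAtlas.isFace_chamber_iff D).1 hD.1
  have hne : m' ≠ m := fun h' => hDm (by rw [h'])
  have hsign : m'.1 = -m.1 := by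
    let C : P.S.Chamber n := ⟨range (φ m), (h.isAtlas.isFace_chamber_iff _).2 ⟨m, rfl⟩⟩
    let C' : P.S.Chamber n := ⟨range (φ m'), (h.isAtlas.isFace_chamber_iff _).2 ⟨m', rfl⟩⟩
    rw [← h.sign_eq C m rfl, ← h.sign_eq C' m' rfl]
    exact P.coloring.sign_adjacent C C' A (fun h' => hDm (congrArg Subtype.val h').symm)
      ((hmem m).2 hm).2 hD.2
  refine ⟨m'.2, fun l => ?_⟩
  rw [← hsign, ← hmem]
  have hset : {range (φ m), range (φ m')} = {C | P.S.IsFace n C ∧ A.1 ⊆ C} := by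
    refine eq_of_subset_of_ncard_le ?_ ?_ (finite_of_ncard_ne_zero (by omega))
    · rintro _ (rfl | rfl)
      · exact (hmem m).2 hm
      · exact hD
    · rw [htwo, ncard_pair (Ne.symm hDm)]
  rw [← hset, mem_insert_iff, mem_singleton_iff, h.isAtlas.range_eq_iff, h.isAtlas.range_eq_iff]

/-- Unique neighbors of plus-chambers and of minus-chambers give two maps of labels, inverse to each
other by symmetry of agreement. -/
theorem IsColoredAtlas.exists_perm {φ : ℤˣ × Fin L → stdSimplex ℝ (Fin (n + 1)) → P.S.Space}
    (h : IsColoredAtlas P φ) (hn : 1 ≤ n) (c : Fin (n + 1)) :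
    ∃ g : Equiv.Perm (Fin L), ∀ a b,
      Agree φ (Finset.univ.erase c) (1, a) (-1, b) ↔ g a = b := by
  have hne : (-1 : ℤˣ) ≠ 1 := by decide
  choose f hf using fun a => h.exists_neighbor hn c (1, a)
  choose f' hf' using fun b => h.exists_neighbor hn c (-1, b)
  have h1 : ∀ a b, Agree φ (Finset.univ.erase c) (1, a) (-1, b) ↔ b = f a := by
    intro a b
    rw [hf]
    simp
  have h2 : ∀ a b, Agree φ (Finset.univ.erase c) (1, a) (-1, b) ↔ a = f' b := by
    intro a b
    rw [show Agree φ (Finset.univ.erase c) (1, a) (-1, b) ↔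
      Agree φ (Finset.univ.erase c) (-1, b) (1, a) from ⟨Agree.symm, Agree.symm⟩, hf']
    simp
  refine ⟨⟨f, f', fun a => ?_, fun b => ?_⟩, fun a b => (h1 a b).trans eq_comm⟩
  · exact ((h2 _ _).1 ((h1 _ _).2 rfl)).symm
  · exact ((h1 _ _).1 ((h2 _ _).2 rfl)).symm

/-- The identifications in a labeled colored pseudomanifold are generated by the gluings
along facets. -/
theorem IsColoredAtlas.exists_agree_iff
    {φ : ℤˣ × Fin L → stdSimplex ℝ (Fin (n + 1)) → P.S.Space}
    (h : IsColoredAtlas P φ) (hn : 1 ≤ n) :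
    ∃ g : Fin (n + 1) → Equiv.Perm (Fin L), ∀ F : Finset (Fin (n + 1)), F.Nonempty → ∀ m m',
      Agree φ F m m' ↔ Gluing.Linked g F m m' := by
  choose g hg using h.exists_perm hn
  refine ⟨g, fun F hF m m' => ⟨fun hm => ?_, fun hm => ?_⟩⟩
  -- Normality is used here, to replace agreement by a gallery.
  · have := h.isAtlas.reflTransGen_facetAdj P.isNormal.link_connected hF hm
    clear hm
    induction this with
    | refl => exact Relation.EqvGen.refl _
    | @tail k l _ hkl ih =>
      refine Relation.EqvGen.trans _ _ _ ih ?_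
      obtain ⟨c, hc, hkl⟩ := hkl
      obtain ⟨b, hb⟩ := h.exists_neighbor hn c k
      rcases (hb l).1 hkl with rfl | rfl
      · exact Relation.EqvGen.refl _
      · obtain ⟨s, a⟩ := k
        rcases Int.units_eq_one_or s with rfl | rfl
        · exact Relation.EqvGen.rel _ _ ⟨c, hc, a, rfl, by rw [(hg c a b).1 hkl]⟩
        -- The generators of `Linked` go from plus to minus, so a crossing from a minus-chamber is
        -- an inverse generator.
        · simp only [neg_neg] at hkl ⊢
          exact Relation.EqvGen.symm _ _ (Relation.EqvGen.rel _ _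
            ⟨c, hc, b, rfl, by rw [(hg c b a).1 hkl.symm]⟩)
  · induction hm with
    | rel _ _ hm =>
      obtain ⟨c, hc, a, rfl, rfl⟩ := hm
      exact FacetAdj.agree ⟨c, hc, (hg c a _).2 rfl⟩
    | refl => exact fun _ _ => rfl
    | symm _ _ _ ih => exact ih.symm
    | trans _ _ _ _ _ ih ih' => exact ih.trans ih'

/-- Every labeled colored pseudomanifold is isomorphic to a glued one. -/
theorem exists_equiv_gluing (P : LabeledColoredPseudomanifold n L) (hn : 1 ≤ n) :
    ∃ g, Gluing.pseudomanifold g hn ≈ P := by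
  obtain ⟨φ, hφ⟩ := P.exists_isColoredAtlas
  obtain ⟨g, hg⟩ := hφ.exists_agree_iff hn
  refine ⟨g, (Gluing.isColoredAtlas g hn).nonempty_iso hφ fun m m' x => ?_⟩
  -- Two charts coincide at `x` exactly when they agree on the smallest face containing `x`, and for
  -- that face agreement is linkedness.
  refine (Gluing.chart_eq_iff (g := g)).trans ?_
  rw [← hg _ (stdSupp_nonempty x)]
  exact ⟨fun h => h.2 x (mem_stdFace_stdSupp x), fun h => ⟨rfl, hφ.isAtlas.agree_of_eq _ _ _ h⟩⟩

end LabeledColoredPseudomanifold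

/-! ### The bijection -/

theorem mainTheorem2 (n L : ℕ) (hn : 1 ≤ n) :
    ∃ e : (Fin (n + 1) → Equiv.Perm (Fin L)) ≃ LabeledColoredPseudomanifold.IsoClass n L,
      (∀ (P : LabeledColoredPseudomanifold n L) (c : Fin (n + 1)) (a b : Fin L),
        e.symm (Quotient.mk _ P) c a = b ↔
          ∃ A : P.S.Facet n, P.coloring.facetColor A = c ∧
            A.1 ⊆ (P.labeling.plus a).1.1 ∧ A.1 ⊆ (P.labeling.minus b).1.1) ∧
      (∀ g : Fin (n + 1) → Equiv.Perm (Fin L),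
        ∃ (hg : (gluing g).IsNormalPseudomanifold n) (κ : (gluing g).Coloring n)
          (lab : SimplexQuotient.Labeling κ L),
          IsStandardLabeling g κ lab ∧
            e g = Quotient.mk _ (LabeledColoredPseudomanifold.mk (gluing g) hg κ lab)) := by
  let E : (Fin (n + 1) → Equiv.Perm (Fin L)) → LabeledColoredPseudomanifold.IsoClass n L :=
    fun g => Quotient.mk _ (Gluing.pseudomanifold g hn)
  have hE : Function.Bijective E := by
    constructor
    -- Adjacency is invariant under isomorphism and gives back the permutations.
    · intro g g' h
      funext c
      ext1 a
      rw [← Gluing.adjacent_iff g hn, LabeledColoredPseudomanifold.adjacent_iff_of_equiv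
        (Quotient.exact h), Gluing.adjacent_iff]
    · intro q
      induction q using Quotient.ind with
      | _ P =>
        obtain ⟨g, hg⟩ := P.exists_equiv_gluing hn
        exact ⟨g, Quotient.sound hg⟩
  refine ⟨Equiv.ofBijective E hE, fun P c a b => ?_, fun g => ⟨Gluing.isNormalPseudomanifold g,
    Gluing.coloring g hn, Gluing.labeling g hn, Gluing.isStandardLabeling g hn, rfl⟩⟩
  -- Since `P` is isomorphic to the space glued from its permutations, adjacency may be computed in
  -- that space.
  have hP : E ((Equiv.ofBijective E hE).symm (Quotient.mk _ P)) = Quotient.mk _ P :=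
    (Equiv.ofBijective E hE).apply_symm_apply _
  rw [← Gluing.adjacent_iff _ hn,
    LabeledColoredPseudomanifold.adjacent_iff_of_equiv (Quotient.exact hP)]
  rfl
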